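/- **Theorem (Asymptotic normality of the emulator-based estimator).** *Model.* Let $f$ be a probability density on $\mathbb{R}^K$ with exchangeable coordinates and let $\epsilon^*$ have density $f$. For $v\in\mathbb{R}^K$ and a positive semidefinite $K\times K$ matrix $\Sigma$, put $U_j=v_j+(\Sigma^{1/2}\epsilon^*)_j$, with $\Sigma^{1/2}$ the positive semidefinite square root, and $P_j(v,\Sigma)=\Pr(U_j\ge U_k\text{ for all }k\ne j)$. Let $\Theta\subset\mathbb{R}^p$, let $(X,\theta)\mapsto v^*(X,\theta)\in\mathbb{R}^K$ and $(X,\theta)\mapsto\Sigma^*(X,\theta)$ (positive semidefinite) be given, and suppose that for all $X$ and all $\theta\in\Theta$ the utilities at $(v^*(X,\theta),\Sigma^*(X,\theta))$ are almost surely pairwise distinct and all choice probabilities are positive and measurable in $X$. Put $$m(y,X;\theta)=\log P_y\{v^*(X,\theta),\Sigma^*(X,\theta)\},\qquad \psi=\nabla_\theta m .$$ Let $(y_i,X_i)$, $i\ge1$, be i.i.d. from the model with parameter $\theta_0$: $X_i$ has some law $Q$ and $\Pr(y_i=j\mid X_i)=P_j\{v^*(X_i,\theta_0),\Sigma^*(X_i,\theta_0)\}$.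 Let $\ell_n(\theta)=\frac1n\sum_{i=1}^n m(y_i,X_i;\theta)$. *Emulator.* Let $\hat P_j(v,\Sigma;\phi)>0$ be any emulator of the choice probabilities with weights $\phi$, let $\phi_n$ be (possibly random) weights, and let $\hat\ell_n(\theta)=\frac1n\sum_{i=1}^n\log\hat P_{y_i}\{v^*(X_i,\theta),\Sigma^*(X_i,\theta);\phi_n\}$. Let $\hat\theta_n$ be a random vector in $\Theta$ that maximizes $\hat\ell_n$ over $\Theta$, exactly or up to an error $o_p(n^{-1})$, i.e. $\hat\ell_n(\hat\theta_n)\ge\sup_{\theta\in\Theta}\hat\ell_n(\theta)-o_p(n^{-1})$. *Assumptions.* 1. For some $\alpha\ge1$, $\ \sup_{\theta\in\Theta}|\hat\ell_n(\theta)-\ell_n(\theta)|=o_p(n^{-\alpha})$. 2. (i) $\Theta$ is compact, $\theta_0\in\mathrm{int}(\Theta)$ is the unique maximizer over $\Theta$ of $\mathbb{E}\{m(y,X;\theta)\}\in[-\infty,0]$, and $\mathbb{E}|m(y,X;\theta_0)|<\infty$; (ii) for all $(y,X)$, $m(y,X;\cdot)$ is continuous on $\Theta$ and twice continuously differentiable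 in $\mathrm{int}(\Theta)$; (iii) $\mathbb{E}\{\sup_{\theta\in\mathrm{int}(\Theta)}\|\psi(y,X;\theta)\|^2\}<\infty$; (iv) $\mathbb{E}\{\sup_{\theta\in\mathrm{int}(\Theta)}\|\nabla_\theta^2m(y,X;\theta)\|\}<\infty$; (v) $J(\theta_0)=\mathbb{E}\{\psi(y,X;\theta_0)\psi(y,X;\theta_0)^\top\}$ is positive definite. *Conclusion.* As $n\to\infty$, $$\sqrt n(\hat\theta_n-\theta_0)\xrightarrow{d}\mathcal{N}\{0,J(\theta_0)^{-1}\}.$$ -/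

import Mathlib

open MeasureTheory ProbabilityTheory Filter Topology
open scoped ENNReal MatrixOrder Gradient

noncomputable section

/-- The law on `ℝ^K` with Lebesgue density `f`. -/
def errorLaw {K : ℕ} (f : (Fin K → ℝ) → ℝ) : Measure (Fin K → ℝ) :=
  volume.withDensity fun e => ENNReal.ofReal (f e)

/-- `f` is a probability density on `ℝ^K` with exchangeable coordinates. -/
structure IsErrorDensity {K : ℕ} (f : (Fin K → ℝ) → ℝ) : Prop where
  measurable : Measurable f
  nonneg : ∀ e, 0 ≤ f e
  lintegral_eq_one : ∫⁻ e, ENNReal.ofReal (f e) = 1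
  exchangeable : ∀ (π : Equiv.Perm (Fin K)) (e : Fin K → ℝ), f (fun j => e (π j)) = f e

/-- The latent utilities `U_j = v_j + ε_j` with `ε = Σ^{1/2} ε*`, where `S = Σ` and `e = ε*`. The
root is the positive semidefinite one. -/
def latentUtility {K : ℕ} (v : Fin K → ℝ) (S : Matrix (Fin K) (Fin K) ℝ) (e : Fin K → ℝ)
    (j : Fin K) : ℝ :=
  v j + (CFC.sqrt S).mulVec e j

/-- The choice probability `P_j(v, Σ) = Pr(U_j ≥ U_k for all k ≠ j)`. -/
def choiceProb {K : ℕ} (f : (Fin K → ℝ) → ℝ) (v : Fin K → ℝ) (S : Matrix (Fin K) (Fin K) ℝ)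
    (j : Fin K) : ℝ :=
  (errorLaw f).real {e | ∀ k, k ≠ j → latentUtility v S e k ≤ latentUtility v S e j}

/-- A parametric discrete choice model with `K` alternatives, covariates in `𝒳` and a parameter
in `ℝ^p`: the density of `ε*` and the maps `(X, θ) ↦ v*(X, θ)` and `(X, θ) ↦ Σ*(X, θ)`. -/
structure ChoiceModel (K p : ℕ) (𝒳 : Type*) where
  errorDensity : (Fin K → ℝ) → ℝ
  utility : 𝒳 → EuclideanSpace ℝ (Fin p) → Fin K → ℝ
  scale : 𝒳 → EuclideanSpace ℝ (Fin p) → Matrix (Fin K) (Fin K) ℝ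

namespace ChoiceModel

variable {K p : ℕ} {𝒳 : Type*}

/-- The probability of alternative `j` given covariates `x`, at the parameter `θ`. -/
def prob (M : ChoiceModel K p 𝒳) (x : 𝒳) (θ : EuclideanSpace ℝ (Fin p)) (j : Fin K) : ℝ :=
  choiceProb M.errorDensity (M.utility x θ) (M.scale x θ) j

/-- The log-likelihood contribution `m(y, X; θ)` of the observation `z = (X, y)`. -/
def logLik (M : ChoiceModel K p 𝒳) (z : 𝒳 × Fin K) (θ : EuclideanSpace ℝ (Fin p)) : ℝ :=
  Real.log (M.prob z.1 θ z.2)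

/-- The score `ψ(y, X; θ)`, the gradient of `m` in `θ`. -/
def score (M : ChoiceModel K p 𝒳) (z : 𝒳 × Fin K) (θ : EuclideanSpace ℝ (Fin p)) :
    EuclideanSpace ℝ (Fin p) :=
  ∇ (M.logLik z) θ

/-- The Hessian of `m` in `θ`, as an operator on `ℝ^p`. -/
def hessian (M : ChoiceModel K p 𝒳) (z : 𝒳 × Fin K) (θ : EuclideanSpace ℝ (Fin p)) :
    EuclideanSpace ℝ (Fin p) →L[ℝ] EuclideanSpace ℝ (Fin p) :=
  fderiv ℝ (M.score z) θ

/-- The model makes sense on the parameter set `Θ`: the errors have an exchangeable density, the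
scale matrices are positive semidefinite, ties between utilities have probability zero (so that
the choice `argmax_j U_j` is almost surely defined), the choice probabilities are positive (so that
`m` is finite), and they are measurable in the covariates. -/
structure IsProper [MeasurableSpace 𝒳] (M : ChoiceModel K p 𝒳)
    (Θ : Set (EuclideanSpace ℝ (Fin p))) : Prop where
  errorDensity : IsErrorDensity M.errorDensity
  scale_posSemidef : ∀ x, ∀ θ ∈ Θ, (M.scale x θ).PosSemidef
  no_ties : ∀ x, ∀ θ ∈ Θ, ∀ j k, j ≠ k → ∀ᵐ e ∂errorLaw M.errorDensity,
    latentUtility (M.utility x θ) (M.scale x θ) e j ≠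
      latentUtility (M.utility x θ) (M.scale x θ) e k
  prob_pos : ∀ x, ∀ θ ∈ Θ, ∀ j, 0 < M.prob x θ j
  prob_measurable : ∀ θ ∈ Θ, ∀ j, Measurable fun x => M.prob x θ j

/-- The law of one observation `(X, y)` when `X` has law `Q` and, given `X = x`, the choice `y`
equals `j` with probability `P_j(v*(x, θ), Σ*(x, θ))`. -/
def observationLaw [MeasurableSpace 𝒳] (M : ChoiceModel K p 𝒳) (Q : Measure 𝒳)
    (θ : EuclideanSpace ℝ (Fin p)) : Measure (𝒳 × Fin K) :=
  ∑ j, (Q.withDensity fun x => ENNReal.ofReal (M.prob x θ j)).map fun x => (x, j)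

/-- `E{m(y, X; θ)}` under the law `D` of `(X, y)`, as an extended real number in `[-∞, 0]`
(`m ≤ 0`, being the logarithm of a probability). -/
def expectedLogLik [MeasurableSpace 𝒳] (M : ChoiceModel K p 𝒳) (D : Measure (𝒳 × Fin K))
    (θ : EuclideanSpace ℝ (Fin p)) : EReal :=
  -((∫⁻ z, ENNReal.ofReal (-M.logLik z θ) ∂D : ℝ≥0∞) : EReal)

/-- The matrix `J(θ) = E{ψ(y, X; θ) ψ(y, X; θ)ᵀ}` under the law `D` of `(X, y)`. -/
def fisherInfo [MeasurableSpace 𝒳] (M : ChoiceModel K p 𝒳) (D : Measure (𝒳 × Fin K))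
    (θ : EuclideanSpace ℝ (Fin p)) : Matrix (Fin p) (Fin p) ℝ :=
  Matrix.of fun a b => ∫ z, M.score z θ a * M.score z θ b ∂D

/-- The regularity conditions on the model, where `D` is the law of `(X, y)` and `θ₀` the true
parameter. Smoothness on the compact set `Θ` is continuity on `Θ` together with two continuous
derivatives in its interior, and the suprema of the derivatives run over the interior. -/
structure IsRegular [MeasurableSpace 𝒳] (M : ChoiceModel K p 𝒳)
    (Θ : Set (EuclideanSpace ℝ (Fin p))) (D : Measure (𝒳 × Fin K))
    (θ₀ : EuclideanSpace ℝ (Fin p)) : Prop where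
  isCompact : IsCompact Θ
  mem_interior : θ₀ ∈ interior Θ
  unique_max : ∀ θ ∈ Θ, θ ≠ θ₀ → M.expectedLogLik D θ < M.expectedLogLik D θ₀
  integrable : Integrable (fun z => M.logLik z θ₀) D
  continuousOn : ∀ z, ContinuousOn (M.logLik z) Θ
  contDiffOn : ∀ z, ContDiffOn ℝ 2 (M.logLik z) (interior Θ)
  score_bound : ∫⁻ z, ⨆ θ ∈ interior Θ, ‖M.score z θ‖ₑ ^ 2 ∂D < ∞
  hessian_bound : ∫⁻ z, ⨆ θ ∈ interior Θ, ‖M.hessian z θ‖ₑ ∂D < ∞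
  fisherInfo_posDef : (M.fisherInfo D θ₀).PosDef

/-- The averaged log-likelihood `ℓ_n(θ)` of the observations `z 0, …, z (n - 1)`. -/
def avgLogLik (M : ChoiceModel K p 𝒳) (n : ℕ) (z : ℕ → 𝒳 × Fin K)
    (θ : EuclideanSpace ℝ (Fin p)) : ℝ :=
  (∑ i ∈ Finset.range n, M.logLik (z i) θ) / n

/-- The averaged log-likelihood at `θ` of the observations `z 0, …, z (n - 1)`, computed from an
emulator: a function `P` that sends `(v, Σ)` to approximate choice probabilities. -/
def emulatorAvgLogLik (M : ChoiceModel K p 𝒳)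
    (P : (Fin K → ℝ) → Matrix (Fin K) (Fin K) ℝ → Fin K → ℝ) (n : ℕ) (z : ℕ → 𝒳 × Fin K)
    (θ : EuclideanSpace ℝ (Fin p)) : ℝ :=
  (∑ i ∈ Finset.range n,
    Real.log (P (M.utility (z i).1 θ) (M.scale (z i).1 θ) (z i).2)) / n

end ChoiceModel

/-- `Z n = o_p(r n)` for nonnegative `Z n`. For `Z n` that need not be measurable the measure is
the outer measure. -/
def IsLittleOInProb {Ω : Type*} [MeasurableSpace Ω] (μ : Measure Ω) (Z : ℕ → Ω → ℝ≥0∞)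
    (r : ℕ → ℝ) : Prop :=
  ∀ δ : ℝ, 0 < δ → Tendsto (fun n => μ {ω | ENNReal.ofReal (δ * r n) < Z n ω}) atTop (𝓝 0)

end

set_option linter.unusedSectionVars false

/-! The emulator matters only through its uniform error. Since `α ≥ 1`, replacing the emulated
criterion by the likelihood twice, at the estimator and at a competitor, costs `o_p(1/n)`. So `θhat`
maximizes the true sum of log-likelihoods up to `o_p(1)`
(`ChoiceModel.tendsto_measure_exists_logLik_gt`), and the rest is classical maximum likelihood
theory for approximate maximizers.

Consistency is Wald's argument (`tendsto_measure_approx_max_far`). As `m ≤ 0`, near each wrong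
parameter `m` lies below an integrable function with mean smaller than that of `m` at `θ₀`; the law
of large numbers and compactness exclude the complement of any ball around `θ₀`.

For the limit law, put `X = J⁻¹ n^(-1/2) ∑ ψ` and `u = √n (θ - θ₀)`. The change of the summed
log-likelihood from `θ₀` to `θ` is `⟪J X, u⟫ - ⟪u, J u⟫ / 2` up to `κ ‖u‖ ^ 2`, for any fixed `κ >
0`, with probability tending to one and uniformly near `θ₀`: the mean oscillation of the Hessian
vanishes as the ball shrinks (`exists_mean_quadratic_expansion`). The main part is uniquely maximal
at `X`. Comparing `θhat` with the competitor `θ₀ + X / √n`, coercivity of `J` absorbs the error, so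
that `√n (θhat - θ₀) - X` tends to zero in probability (`tendstoInMeasure_sqrt_smul_sub`). No
separate proof of the `√n` rate is needed, and the score equation, which `θhat` need not solve, is
never used.

Differentiating `∑ P_j = 1` twice gives mean zero of the score and the information equality. Hence
the central limit theorem gives `X` the limit covariance `J⁻¹ J J⁻¹ = J⁻¹`, and Slutsky's theorem
concludes. Events about the estimator and the suprema are handled only by monotonicity and
subadditivity, which hold for outer measure. -/

noncomputable section

/-! ### Measurability of uncountable suprema and infima -/

/-- A supremum over a subset of a second countable space of functions which are continuous on that
subset is measurable. -/
lemma measurable_biSup_of_continuousOn {α T : Type*} [MeasurableSpace α] [TopologicalSpace T]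
    [SecondCountableTopology T] {S : Set T} {f : α → T → ℝ≥0∞}
    (hf : ∀ a, ContinuousOn (f a) S) (hm : ∀ t ∈ S, Measurable fun a => f a t) :
    Measurable fun a => ⨆ t ∈ S, f a t := by
  obtain ⟨C, hC, hd⟩ := TopologicalSpace.exists_countable_dense S
  -- By continuity a bound on a countable dense subset holds on all of `S`.
  have key : (fun a => ⨆ t ∈ S, f a t) = fun a => ⨆ t ∈ C, f a t := by
    funext a
    rw [iSup_subtype']
    refine le_antisymm (iSup_le fun t => ?_) (iSup₂_le fun t _ => le_iSup (fun t : S => f a t) t)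
    have hcl : IsClosed {t : S | f a t ≤ ⨆ s ∈ C, f a s} :=
      isClosed_le (continuousOn_iff_continuous_domRestrict.mp (hf a)) continuous_const
    have hsub : C ⊆ {t : S | f a t ≤ ⨆ s ∈ C, f a s} := fun s hs =>
      le_iSup₂ (f := fun (s : S) (_ : s ∈ C) => f a s) s hs
    exact hcl.closure_subset_iff.mpr hsub (hd t)
  rw [key]
  exact Measurable.biSup C hC fun t _ => hm t t.2

/-- An infimum over a subset of a second countable space of functions which are continuous on that
subset is measurable. -/
lemma measurable_biInf_of_continuousOn {α T : Type*} [MeasurableSpace α] [TopologicalSpace T]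
    [SecondCountableTopology T] {S : Set T} {f : α → T → ℝ≥0∞}
    (hf : ∀ a, ContinuousOn (f a) S) (hm : ∀ t ∈ S, Measurable fun a => f a t) :
    Measurable fun a => ⨅ t ∈ S, f a t := by
  -- Inversion on `[0, ∞]` is continuous and exchanges infima with suprema.
  have := (measurable_biSup_of_continuousOn (f := fun a t => (f a t)⁻¹)
    (fun a => (continuous_inv.comp_continuousOn (hf a))) (fun t ht => (hm t ht).inv)).inv
  convert this using 2 with a
  simp [Pi.inv_apply, ENNReal.inv_iSup]

/-! ### Law of large numbers and multivariate central limit theorem -/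

section LimitTheorems

variable {Ω 𝒵 : Type*} [MeasurableSpace Ω] [MeasurableSpace 𝒵] {μ : Measure Ω}
  [IsProbabilityMeasure μ] {D : Measure 𝒵} {Z : ℕ → Ω → 𝒵}

lemma identDistrib_comp_of_hasLaw {F : Type*} [MeasurableSpace F]
    (hlaw : ∀ i, HasLaw (Z i) D μ) {g : 𝒵 → F} (hg : Measurable g) (i j : ℕ) :
    IdentDistrib (fun ω => g (Z i ω)) (fun ω => g (Z j ω)) μ μ :=
  IdentDistrib.comp ⟨(hlaw i).aemeasurable, (hlaw j).aemeasurable,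
    by rw [(hlaw i).map_eq, (hlaw j).map_eq]⟩ hg

/-- The weak law of large numbers for a function of independent observations with law `D`. -/
lemma tendstoInMeasure_average {F : Type*} [NormedAddCommGroup F] [NormedSpace ℝ F]
    [CompleteSpace F] [SecondCountableTopology F] [MeasurableSpace F] [BorelSpace F]
    (hindep : iIndepFun Z μ) (hlaw : ∀ i, HasLaw (Z i) D μ) {g : 𝒵 → F} (hg : Measurable g)
    (hint : Integrable g D) :
    TendstoInMeasure μ (fun (n : ℕ) ω => (n : ℝ)⁻¹ • ∑ i ∈ Finset.range n, g (Z i ω)) atTop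
      (fun _ => ∫ z, g z ∂D) := by
  have hint0 : Integrable (fun ω => g (Z 0 ω)) μ := by
    rw [← (hlaw 0).map_eq] at hint
    exact hint.comp_aemeasurable (hlaw 0).aemeasurable
  have hmean : ∫ z, g z ∂D = ∫ ω, g (Z 0 ω) ∂μ :=
    ((hlaw 0).integral_comp hint.aestronglyMeasurable).symm
  rw [hmean]
  refine tendstoInMeasure_of_tendsto_ae (fun n => ?_) ?_
  · have (i : ℕ) : AEMeasurable (fun ω => g (Z i ω)) μ :=
      hg.comp_aemeasurable (hlaw i).aemeasurable
    have hs : AEMeasurable (fun ω => ∑ i ∈ Finset.range n, g (Z i ω)) μ :=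
      Finset.aemeasurable_fun_sum _ fun i _ => this i
    exact (hs.const_smul _).aestronglyMeasurable
  · exact strong_law_ae (fun i ω => g (Z i ω)) hint0
      (fun i j hij => (hindep.indepFun hij).comp hg hg)
      (fun i => identDistrib_comp_of_hasLaw hlaw hg i 0)

lemma tendsto_measure_average {g : 𝒵 → ℝ}
    (hindep : iIndepFun Z μ) (hlaw : ∀ i, HasLaw (Z i) D μ) (hg : Measurable g)
    (hint : Integrable g D) {ε : ℝ} (hε : 0 < ε) :
    Tendsto (fun n : ℕ => μ {ω | ε ≤ |(∑ i ∈ Finset.range n, g (Z i ω)) / n - ∫ z, g z ∂D|})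
      atTop (𝓝 0) := by
  have h := tendstoInMeasure_average hindep hlaw hg hint
  rw [tendstoInMeasure_iff_norm] at h
  have := h ε hε
  simpa [Real.norm_eq_abs, div_eq_inv_mul] using this

/-- The central limit theorem in `ℝ^p`. -/
lemma tendstoInDistribution_multivariateGaussian {p : ℕ} {g : 𝒵 → EuclideanSpace ℝ (Fin p)}
    {S : Matrix (Fin p) (Fin p) ℝ} (hS : S.PosSemidef)
    (hindep : iIndepFun Z μ) (hlaw : ∀ i, HasLaw (Z i) D μ) (hg : Measurable g)
    (hL2 : MemLp g 2 D) (hmean : ∀ t, ∫ z, inner ℝ (g z) t ∂D = 0)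
    (hcov : ∀ t : EuclideanSpace ℝ (Fin p),
      ∫ z, (inner ℝ (g z) t) ^ 2 ∂D = t.ofLp ⬝ᵥ S.mulVec t.ofLp) :
    TendstoInDistribution (fun (n : ℕ) ω => (√(n : ℝ))⁻¹ • ∑ i ∈ Finset.range n, g (Z i ω)) atTop
      id (fun _ => μ) (multivariateGaussian 0 S) := by
  have hmeas (n : ℕ) :
      AEMeasurable (fun ω => (√(n : ℝ))⁻¹ • ∑ i ∈ Finset.range n, g (Z i ω)) μ := by
    have hs : AEMeasurable (fun ω => ∑ i ∈ Finset.range n, g (Z i ω)) μ :=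
      Finset.aemeasurable_fun_sum _ fun i _ => hg.comp_aemeasurable (hlaw i).aemeasurable
    exact hs.const_smul (√(n : ℝ))⁻¹
  refine ⟨hmeas, aemeasurable_id, ?_⟩
  refine ProbabilityMeasure.tendsto_iff_tendsto_charFun.2 fun t => ?_
  have hgt : Measurable fun z => inner ℝ (g z) t := hg.inner_const
  have hL2t : MemLp (fun z => inner ℝ (g z) t) 2 D := hL2.inner_const t
  have hX0 : MemLp (fun ω => inner ℝ (g (Z 0 ω)) t) 2 μ := by
    rw [← (hlaw 0).map_eq] at hL2t
    exact hL2t.comp_of_map (hlaw 0).aemeasurable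
  have hmean0 : ∫ ω, inner ℝ (g (Z 0 ω)) t ∂μ = 0 := by
    rw [← hmean t, ← (hlaw 0).integral_comp hgt.aestronglyMeasurable]; rfl
  have hvar : Var[fun ω => inner ℝ (g (Z 0 ω)) t; μ] = t.ofLp ⬝ᵥ S.mulVec t.ofLp := by
    rw [variance_of_integral_eq_zero hX0.aestronglyMeasurable.aemeasurable hmean0, ← hcov t,
      ← (hlaw 0).integral_comp (hgt.pow_const 2).aestronglyMeasurable]
    rfl
  have hnn : 0 ≤ t.ofLp ⬝ᵥ S.mulVec t.ofLp := hvar ▸ variance_nonneg _ _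
  have clt := tendstoInDistribution_inv_sqrt_mul_sum_sub
    (P' := gaussianReal 0 (Var[fun ω => inner ℝ (g (Z 0 ω)) t; μ]).toNNReal) (Y := id)
    (X := fun i ω => inner ℝ (g (Z i ω)) t) HasLaw.id hX0
    (hindep.comp (fun _ z => inner ℝ (g z) t) fun _ => hgt)
    (fun i => identDistrib_comp_of_hasLaw hlaw hgt i 0)
  -- Cramér–Wold: the characteristic function of the vector at `t` is that of its scalar product
  -- with `t` at `1`.
  have h1 := ProbabilityMeasure.tendsto_iff_tendsto_charFun.1 clt.tendsto 1
  simp only [ProbabilityMeasure.coe_mk, Measure.map_id] at h1 ⊢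
  rw [charFun_multivariateGaussian hS]
  rw [charFun_gaussianReal, hvar] at h1
  convert h1 using 1
  · funext n
    rw [charFun_apply, charFun_apply, integral_map (hmeas n) (by fun_prop), integral_map
      (by
        refine AEMeasurable.const_mul (AEMeasurable.sub_const (Finset.aemeasurable_fun_sum _
          fun i _ => hgt.comp_aemeasurable (hlaw i).aemeasurable) _) _) (by fun_prop)]
    refine integral_congr_ae (ae_of_all _ fun ω => ?_)
    simp [hmean0, inner_smul_left, sum_inner]
  · simp [hnn]

end LimitTheorems

/-! ### Wald consistency -/

section Consistency

variable {Ω 𝒵 T : Type*} [MeasurableSpace Ω] [MeasurableSpace 𝒵] {μ : Measure Ω}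
  [IsProbabilityMeasure μ] {D : Measure 𝒵} [IsProbabilityMeasure D] {Z : ℕ → Ω → 𝒵}
  [MetricSpace T] [SecondCountableTopology T] {Θ : Set T} {θ₀ θ : T} {m : 𝒵 → T → ℝ}

/-- Wald's envelope: near a parameter whose expected criterion is smaller than `a`, the criterion
is dominated by an integrable function whose integral is smaller than `a`. -/
lemma exists_integrable_envelope (hmeas : ∀ θ ∈ Θ, Measurable fun z => m z θ)
    (hcont : ∀ z, ContinuousOn (m z) Θ) (hneg : ∀ z, ∀ θ ∈ Θ, m z θ ≤ 0) (hθ : θ ∈ Θ)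
    {a : ℝ} (ha : a ≤ 0) (hlt : ENNReal.ofReal (-a) < ∫⁻ z, ENNReal.ofReal (-m z θ) ∂D) :
    ∃ s > 0, ∃ f : 𝒵 → ℝ, Measurable f ∧ Integrable f D ∧ ∫ z, f z ∂D < a ∧
      ∀ z, ∀ θ' ∈ Θ ∩ Metric.ball θ s, m z θ' ≤ f z := by
  set B : ℕ → Set T := fun k => Θ ∩ Metric.ball θ (1 / (k + 1)) with hB
  -- Truncation at `k` keeps `g k` integrable even when `-m z θ` has infinite mean. The balls shrink
  -- while the truncation level rises, so `g` increases and monotone convergence applies.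
  set g : ℕ → 𝒵 → ℝ≥0∞ := fun k z => min (⨅ t ∈ B k, ENNReal.ofReal (-m z t)) k with hg
  have hgm (k : ℕ) : Measurable (g k) := by
    refine Measurable.min (measurable_biInf_of_continuousOn (fun z => ?_) fun t ht => ?_)
      measurable_const
    · exact ENNReal.continuous_ofReal.comp_continuousOn
        (((hcont z).mono Set.inter_subset_left).neg)
    · exact (hmeas t ht.1).neg.ennreal_ofReal
  have hBanti {i j : ℕ} (hij : i ≤ j) : B j ⊆ B i := by
    refine Set.inter_subset_inter_right _ (Metric.ball_subset_ball ?_)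
    exact one_div_le_one_div_of_le (by positivity) (by exact_mod_cast Nat.succ_le_succ hij)
  have hgmono : Monotone g := fun i j hij z =>
    min_le_min (biInf_mono fun t ht => hBanti hij ht) (by exact_mod_cast hij)
  have hgsup (z : 𝒵) : ⨆ k, g k z = ENNReal.ofReal (-m z θ) := by
    refine le_antisymm (iSup_le fun k => (min_le_left _ _).trans
      (iInf₂_le θ ⟨hθ, Metric.mem_ball_self (by positivity)⟩)) ?_
    refine le_of_forall_lt fun b hb => ?_
    obtain ⟨b', hbb', hb'⟩ := exists_between hb
    have hc : ContinuousWithinAt (fun t => ENNReal.ofReal (-m z t)) Θ θ :=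
      (ENNReal.continuous_ofReal.comp_continuousOn (hcont z).neg) θ hθ
    have hev := hc.eventually (lt_mem_nhds hb')
    obtain ⟨s, hs, hsub⟩ := Metric.mem_nhdsWithin_iff.mp hev
    obtain ⟨k₁, hk₁⟩ := exists_nat_one_div_lt hs
    obtain ⟨k₂, hk₂⟩ := ENNReal.exists_nat_gt (ne_top_of_lt hb')
    -- `k₁` makes the ball small enough for continuity, `k₂` lifts the truncation above `b'`.
    refine lt_of_lt_of_le hbb' (le_trans ?_ (le_iSup _ (max k₁ k₂)))
    refine le_min (le_iInf₂ fun t ht => ?_) (hk₂.le.trans (by exact_mod_cast le_max_right _ _))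
    refine (hsub ⟨?_, ht.1⟩).le
    exact Metric.ball_subset_ball hk₁.le (hBanti (le_max_left k₁ k₂) ht).2
  have hlim : ∫⁻ z, ENNReal.ofReal (-m z θ) ∂D = ⨆ k, ∫⁻ z, g k z ∂D := by
    simp_rw [← hgsup]
    exact lintegral_iSup hgm hgmono
  rw [hlim] at hlt
  obtain ⟨k, hk⟩ := lt_iSup_iff.mp hlt
  have hgk (z : 𝒵) : g k z ≤ k := min_le_right _ _
  have hgtop (z : 𝒵) : g k z ≠ ∞ := ne_top_of_le_ne_top (ENNReal.natCast_ne_top k) (hgk z)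
  have hint_ne : ∫⁻ z, g k z ∂D ≠ ∞ := by
    refine ne_top_of_le_ne_top ?_ (lintegral_mono hgk)
    simp
  refine ⟨1 / (k + 1), by positivity, fun z => -(g k z).toReal, (hgm k).ennreal_toReal.neg,
    (integrable_toReal_of_lintegral_ne_top (hgm k).aemeasurable hint_ne).neg, ?_, ?_⟩
  · rw [integral_neg, integral_toReal (hgm k).aemeasurable (ae_of_all _ fun z => (hgtop z).lt_top)]
    have := (ENNReal.toReal_lt_toReal ENNReal.ofReal_ne_top hint_ne).mpr hk
    rw [ENNReal.toReal_ofReal (by linarith)] at this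
    linarith
  · intro z t ht
    have h1 : g k z ≤ ENNReal.ofReal (-m z t) := (min_le_left _ _).trans (iInf₂_le t ht)
    have h2 := ENNReal.toReal_mono ENNReal.ofReal_ne_top h1
    rw [ENNReal.toReal_ofReal (by linarith [hneg z t ht.1])] at h2
    linarith

/-- Consistency of approximate maximizers of an average of upper bounded criteria over a compact
parameter set. -/
lemma tendsto_measure_approx_max_far (hindep : iIndepFun Z μ) (hlaw : ∀ i, HasLaw (Z i) D μ)
    (hΘ : IsCompact Θ) (hθ₀ : θ₀ ∈ Θ)
    (hmeas : ∀ θ ∈ Θ, Measurable fun z => m z θ)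
    (hcont : ∀ z, ContinuousOn (m z) Θ) (hneg : ∀ z, ∀ θ ∈ Θ, m z θ ≤ 0)
    (hint : Integrable (fun z => m z θ₀) D)
    (hmax : ∀ θ ∈ Θ, θ ≠ θ₀ →
      ∫⁻ z, ENNReal.ofReal (-m z θ₀) ∂D < ∫⁻ z, ENNReal.ofReal (-m z θ) ∂D)
    {θhat : ℕ → Ω → T} (hmem : ∀ n, ∀ᵐ ω ∂μ, θhat n ω ∈ Θ)
    (happrox : ∀ δ : ℝ, 0 < δ → Tendsto (fun n : ℕ => μ {ω |
      (∑ i ∈ Finset.range n, m (Z i ω) (θhat n ω)) / n + δ <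
        (∑ i ∈ Finset.range n, m (Z i ω) θ₀) / n}) atTop (𝓝 0))
    {r : ℝ} (hr : 0 < r) :
    Tendsto (fun n => μ {ω | r ≤ dist (θhat n ω) θ₀}) atTop (𝓝 0) := by
  have hcompact : IsCompact (Θ \ Metric.ball θ₀ r) := hΘ.diff Metric.isOpen_ball
  suffices h : Tendsto (fun n => μ {ω | θhat n ω ∈ Θ \ Metric.ball θ₀ r}) atTop (𝓝 0) by
    refine tendsto_of_tendsto_of_tendsto_of_le_of_le tendsto_const_nhds h
      (fun _ => zero_le) fun n => measure_mono_ae ?_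
    filter_upwards [hmem n] with ω hω hd
    exact ⟨hω, fun h => (Metric.mem_ball.mp h).not_ge hd⟩
  -- Sets in which the estimator falls with vanishing probability are stable under subsets and
  -- finite unions, so by compactness a neighbourhood of each point suffices.
  refine hcompact.induction_on (p := fun S => Tendsto (fun n => μ {ω | θhat n ω ∈ S}) atTop (𝓝 0))
    (by simp) ?_ ?_ ?_
  · intro S S' hSS' hS'
    exact tendsto_of_tendsto_of_tendsto_of_le_of_le tendsto_const_nhds hS'
      (fun _ => zero_le) fun n => measure_mono fun ω hω => hSS' hω
  · intro S S' hS hS'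
    refine tendsto_of_tendsto_of_tendsto_of_le_of_le tendsto_const_nhds
      (by simpa using hS.add hS') (fun _ => zero_le) fun n => ?_
    exact measure_union_le {ω | θhat n ω ∈ S} {ω | θhat n ω ∈ S'}
  · intro θ hθ
    have hne : θ ≠ θ₀ := by
      rintro rfl
      exact hθ.2 (Metric.mem_ball_self hr)
    have ha : ∫ z, m z θ₀ ∂D ≤ 0 := integral_nonpos fun z => hneg z θ₀ hθ₀
    have hlt : ENNReal.ofReal (-∫ z, m z θ₀ ∂D) < ∫⁻ z, ENNReal.ofReal (-m z θ) ∂D := by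
      rw [← integral_neg, ofReal_integral_eq_lintegral_ofReal (f := fun z => -m z θ₀) hint.neg
        (ae_of_all _ fun z => by simpa using hneg z θ₀ hθ₀)]
      exact hmax θ hθ.1 hne
    obtain ⟨s, hs, f, hfm, hfi, hflt, hf⟩ :=
      exists_integrable_envelope hmeas hcont hneg hθ.1 ha hlt
    refine ⟨Θ ∩ Metric.ball θ s, ?_, ?_⟩
    · have : Θ ∩ Metric.ball θ s ∈ 𝓝[Θ] θ := inter_mem_nhdsWithin _ (Metric.ball_mem_nhds _ hs)
      exact nhdsWithin_mono _ Set.sdiff_subset this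
    -- Half the gap between the means: a sampling error below `δ` leaves the average at `θ₀` more
    -- than `δ` above that of the envelope, against a loss of at most `δ / 2`.
    set δ := (∫ z, m z θ₀ ∂D - ∫ z, f z ∂D) / 2 with hδ
    have hδ0 : 0 < δ := by rw [hδ]; linarith
    have hlln := tendsto_measure_average (g := fun z => m z θ₀ - f z) hindep hlaw
      ((hmeas θ₀ hθ₀).sub hfm) (hint.sub hfi) hδ0
    refine tendsto_of_tendsto_of_tendsto_of_le_of_le tendsto_const_nhds
      (by simpa using hlln.add (happrox (δ / 2) (by positivity))) (fun _ => zero_le) fun n => ?_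
    refine le_trans (measure_mono fun ω hω => ?_) (measure_union_le _ _)
    by_contra hcon
    simp only [Set.mem_union, Set.mem_ofPred_eq, not_or, not_le, not_lt] at hcon hω
    obtain ⟨h1, h2⟩ := hcon
    have h3 : (∑ i ∈ Finset.range n, m (Z i ω) (θhat n ω)) / n ≤
        (∑ i ∈ Finset.range n, f (Z i ω)) / n := by
      gcongr with i
      exact hf _ _ hω
    rw [integral_sub hint hfi, sub_div] at h1
    have h4 := (abs_lt.mp h1).1
    linarith

end Consistency

/-! ### Deterministic comparison of near-maximizers of a quadratic -/

section QuadraticExpansion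

variable {E : Type*} [NormedAddCommGroup E] [InnerProductSpace ℝ E]

/-- If `L u ≈ ⟪A x, u⟫ - ⟪u, A u⟫ / 2` near-maximally at `u`, then `u` is close to `x`. -/
lemma norm_sub_sq_le_of_quadratic_expansion {A : E →L[ℝ] E} {c η Lu Lx : ℝ} {x u : E}
    (hsymm : ∀ v w, inner ℝ (A v) w = inner ℝ v (A w)) (hc : ∀ v, c * ‖v‖ ^ 2 ≤ inner ℝ v (A v))
    (hη : 0 ≤ η) (hηc : 8 * η ≤ c)
    (hLu : |Lu - (inner ℝ (A x) u - inner ℝ u (A u) / 2)| ≤ η * ‖u‖ ^ 2)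
    (hLx : |Lx - (inner ℝ (A x) x - inner ℝ x (A x) / 2)| ≤ η * ‖x‖ ^ 2)
    (hmax : Lx ≤ Lu + η) :
    c / 4 * ‖u - x‖ ^ 2 ≤ η * (3 * ‖x‖ ^ 2 + 1) := by
  -- Completing the square, the quadratic falls short of its maximum by `⟪u - x, A (u - x)⟫ / 2`, at
  -- least `c / 2 * ‖u - x‖ ^ 2`. The error in `‖u‖ ^ 2` is split into `u - x` and `x`; as `8 * η ≤
  -- c`, the first part uses up only half of this.
  have h1 := hc (u - x)
  simp only [map_sub, inner_sub_left, inner_sub_right] at h1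
  have h2 : inner ℝ (A x) u = inner ℝ u (A x) := real_inner_comm _ _
  have h3 : inner ℝ (A x) u = inner ℝ x (A u) := hsymm x u
  have h4 : inner ℝ (A x) x = inner ℝ x (A x) := real_inner_comm _ _
  have h5 : ‖u‖ ^ 2 ≤ 2 * ‖u - x‖ ^ 2 + 2 * ‖x‖ ^ 2 := by
    have h6 : ‖u‖ ≤ ‖u - x‖ + ‖x‖ := by simpa using norm_add_le (u - x) x
    nlinarith [sq_nonneg (‖u - x‖ - ‖x‖), norm_nonneg u]
  have h7 := (abs_le.mp hLu).2
  have h8 := (abs_le.mp hLx).1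
  have h9 : η * ‖u‖ ^ 2 ≤ η * (2 * ‖u - x‖ ^ 2 + 2 * ‖x‖ ^ 2) := by gcongr
  have h10 : 8 * η * ‖u - x‖ ^ 2 ≤ c * ‖u - x‖ ^ 2 := by gcongr
  linarith

/-- The sum of quadratic expansions of `m (z i)` along the increment `u / √n`. -/
lemma abs_sum_sub_quadratic_le {𝒵 : Type*} {m : 𝒵 → E → ℝ} {ψ : 𝒵 → E} {H : 𝒵 → E →L[ℝ] E}
    {A H' : E →L[ℝ] E} {w : 𝒵 → ℝ} {θ₀ : E} {r κ : ℝ} {n : ℕ} (hn : 0 < n) {z : ℕ → 𝒵}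
    (hexp : ∀ i, ∀ h, ‖h‖ ≤ r → |m (z i) (θ₀ + h) - m (z i) θ₀ - inner ℝ (ψ (z i)) h
      - inner ℝ h (H (z i) h) / 2| ≤ w (z i) * ‖h‖ ^ 2)
    (hH' : ∀ h, inner ℝ h (H' h) = -inner ℝ h (A h))
    (hH : ‖(n : ℝ)⁻¹ • ∑ i ∈ Finset.range n, H (z i) - H'‖ ≤ κ)
    (hw : (∑ i ∈ Finset.range n, w (z i)) / n ≤ κ / 2)
    {x : E} (hx : A x = (√(n : ℝ))⁻¹ • ∑ i ∈ Finset.range n, ψ (z i))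
    {h : E} (hh : ‖h‖ ≤ r) :
    |(∑ i ∈ Finset.range n, m (z i) (θ₀ + h) - ∑ i ∈ Finset.range n, m (z i) θ₀) -
      (inner ℝ (A x) (√(n : ℝ) • h) - inner ℝ (√(n : ℝ) • h) (A (√(n : ℝ) • h)) / 2)|
      ≤ κ * ‖√(n : ℝ) • h‖ ^ 2 := by
  have hn' : (0 : ℝ) < n := by exact_mod_cast hn
  have hs : 0 < √(n : ℝ) := Real.sqrt_pos.mpr hn'
  have hss : √(n : ℝ) * √(n : ℝ) = n := Real.mul_self_sqrt hn'.le
  set a := (n : ℝ)⁻¹ • ∑ i ∈ Finset.range n, H (z i) with ha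
  have hsum : |∑ i ∈ Finset.range n, (m (z i) (θ₀ + h) - m (z i) θ₀ - inner ℝ (ψ (z i)) h
      - inner ℝ h (H (z i) h) / 2)| ≤ (∑ i ∈ Finset.range n, w (z i)) * ‖h‖ ^ 2 := by
    refine (Finset.abs_sum_le_sum_abs _ _).trans ?_
    rw [Finset.sum_mul]
    exact Finset.sum_le_sum fun i _ => hexp i h hh
  simp only [Finset.sum_sub_distrib, ← Finset.sum_div, ← sum_inner, ← inner_sum] at hsum
  have e1 : ∑ i ∈ Finset.range n, H (z i) h = (n : ℝ) • a h := by
    simp [ha, smul_smul, hn'.ne']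
  have e2 : inner ℝ (A x) (√(n : ℝ) • h) = inner ℝ (∑ i ∈ Finset.range n, ψ (z i)) h := by
    rw [hx, inner_smul_left, inner_smul_right, ← mul_assoc]
    simp [hs.ne']
  have e3 : inner ℝ (√(n : ℝ) • h) (A (√(n : ℝ) • h)) = n * inner ℝ h (A h) := by
    rw [map_smul, inner_smul_left, inner_smul_right, ← mul_assoc]
    simp [hss]
  have e4 : ‖√(n : ℝ) • h‖ ^ 2 = n * ‖h‖ ^ 2 := by
    rw [norm_smul, mul_pow, Real.norm_eq_abs, sq_abs, Real.sq_sqrt hn'.le]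
  -- Halved in the expansion, this contributes `κ / 2`; the averaged remainder `w` supplies the
  -- other `κ / 2`.
  have e5 : |inner ℝ h (a h) - inner ℝ h (H' h)| ≤ κ * ‖h‖ ^ 2 := by
    rw [← inner_sub_right, ← sub_apply]
    refine (abs_real_inner_le_norm _ _).trans ?_
    have := (a - H').le_of_opNorm_le hH h
    nlinarith [norm_nonneg h]
  rw [hH'] at e5
  rw [e1, inner_smul_right] at hsum
  rw [e2, e3, e4]
  rw [div_le_iff₀ hn'] at hw
  have hw' := mul_le_mul_of_nonneg_right hw (sq_nonneg ‖h‖)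
  have e6 := mul_le_mul_of_nonneg_left e5 hn'.le
  rw [← abs_of_pos hn', ← abs_mul, abs_of_pos hn'] at e6
  have e7 := abs_le.mp e6
  have e8 := abs_le.mp hsum
  rw [abs_le]
  constructor <;> nlinarith

end QuadraticExpansion

/-! ### Tightness and asymptotic linearity -/

section AsymptoticLinearity

variable {Ω 𝒵 E : Type*} [MeasurableSpace Ω] [MeasurableSpace 𝒵] {μ : Measure Ω}
  [IsProbabilityMeasure μ] {D : Measure 𝒵} [IsProbabilityMeasure D] {Z : ℕ → Ω → 𝒵}
  [NormedAddCommGroup E] [InnerProductSpace ℝ E] [FiniteDimensional ℝ E] [MeasurableSpace E]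
  [BorelSpace E]

/-- A sequence which converges in distribution is bounded in probability. -/
lemma TendstoInDistribution.exists_eventually_measure_norm_ge_le {Ω' : Type*} [MeasurableSpace Ω']
    {ν : Measure Ω'} [IsProbabilityMeasure ν] {X : ℕ → Ω → E} {Y : Ω' → E}
    (h : TendstoInDistribution X atTop Y (fun _ => μ) ν) {ε : ℝ≥0∞} (hε : 0 < ε) :
    ∃ C : ℝ, 0 < C ∧ ∀ᶠ n in atTop, μ {ω | C ≤ ‖X n ω‖} ≤ ε := by
  have hY := h.aemeasurable_limit
  have : IsProbabilityMeasure (ν.map Y) := Measure.isProbabilityMeasure_map hY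
  have hanti : Antitone fun k : ℕ => {y : E | (k : ℝ) + 1 ≤ ‖y‖} := fun i j hij y hy => by
    simp only [Set.mem_ofPred_eq] at hy ⊢
    exact le_trans (by gcongr) hy
  have hclosed (C : ℝ) : IsClosed {y : E | C ≤ ‖y‖} := isClosed_le continuous_const continuous_norm
  have hlim := tendsto_measure_iInter_atTop (μ := ν.map Y)
    (fun k : ℕ => (hclosed ((k : ℝ) + 1)).measurableSet.nullMeasurableSet) hanti
    ⟨0, measure_ne_top _ _⟩
  have hempty : ⋂ k : ℕ, {y : E | (k : ℝ) + 1 ≤ ‖y‖} = ∅ := by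
    ext y
    simp only [Set.mem_iInter, Set.mem_ofPred_eq, Set.mem_empty_iff_false, iff_false, not_forall,
      not_le]
    obtain ⟨k, hk⟩ := exists_nat_gt ‖y‖
    exact ⟨k, by linarith⟩
  rw [hempty, measure_empty] at hlim
  obtain ⟨k, hk⟩ := (hlim.eventually (gt_mem_nhds hε)).exists
  refine ⟨k + 1, by positivity, ?_⟩
  -- Portmanteau on a closed tail, which has small mass under the limit law.
  have hls := ProbabilityMeasure.limsup_measure_closed_le_of_tendsto h.tendsto
    (hclosed ((k : ℝ) + 1))
  have hev := eventually_lt_of_limsup_lt (lt_of_le_of_lt hls hk)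
  filter_upwards [hev] with n hn
  simp only [ProbabilityMeasure.coe_mk] at hn
  rw [Measure.map_apply_of_aemeasurable (h.forall_aemeasurable n) (hclosed _).measurableSet] at hn
  exact hn.le

/-- Asymptotic linearity of an approximate maximizer of an average criterion that has a quadratic
expansion at `θ₀` with a remainder that is uniformly small in mean. -/
lemma tendstoInMeasure_sqrt_smul_sub {ψ : 𝒵 → E} {H : 𝒵 → E →L[ℝ] E} {A : E →L[ℝ] E}
    {m : 𝒵 → E → ℝ} {Θ : Set E} {θ₀ : E} {X : ℕ → Ω → E}
    (hindep : iIndepFun Z μ) (hlaw : ∀ i, HasLaw (Z i) D μ)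
    (hΘ : Θ ∈ 𝓝 θ₀) (hHm : Measurable H) (hHint : Integrable H D)
    (hsymm : ∀ v w, inner ℝ (A v) w = inner ℝ v (A w))
    {c : ℝ} (hc : 0 < c) (hpos : ∀ v, c * ‖v‖ ^ 2 ≤ inner ℝ v (A v))
    (hHA : ∀ h, ∫ z, inner ℝ h (H z h) ∂D = -inner ℝ h (A h))
    (hexp : ∀ ε : ℝ, 0 < ε → ∃ r > 0, ∃ w : 𝒵 → ℝ, Measurable w ∧ Integrable w D ∧
      ∫ z, w z ∂D ≤ ε ∧ ∀ᵐ z ∂D, ∀ h, ‖h‖ ≤ r →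
        |m z (θ₀ + h) - m z θ₀ - inner ℝ (ψ z) h - inner ℝ h (H z h) / 2| ≤ w z * ‖h‖ ^ 2)
    (hX : ∀ n ω, A (X n ω) = (√(n : ℝ))⁻¹ • ∑ i ∈ Finset.range n, ψ (Z i ω))
    (htight : ∀ ε : ℝ≥0∞, 0 < ε → ∃ C : ℝ, 0 < C ∧ ∀ᶠ n in atTop, μ {ω | C ≤ ‖X n ω‖} ≤ ε)
    {θhat : ℕ → Ω → E}
    (hcons : ∀ r : ℝ, 0 < r → Tendsto (fun n => μ {ω | r ≤ dist (θhat n ω) θ₀}) atTop (𝓝 0))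
    (hmax : ∀ δ : ℝ, 0 < δ → Tendsto (fun n : ℕ => μ {ω | ∃ θ ∈ Θ,
      ∑ i ∈ Finset.range n, m (Z i ω) (θhat n ω) + δ <
        ∑ i ∈ Finset.range n, m (Z i ω) θ}) atTop (𝓝 0)) :
    TendstoInMeasure μ ((fun (n : ℕ) ω => √(n : ℝ) • (θhat n ω - θ₀)) - X) atTop 0 := by
  rw [tendstoInMeasure_iff_norm]
  intro η hη
  rw [ENNReal.tendsto_nhds_zero]
  intro ε hε
  obtain ⟨C, hC, hCev⟩ := htight (ε / 2) (ENNReal.half_pos hε.ne')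
  -- The first bound on `κ` permits absorption by coercivity. The second makes the comparison
  -- contradict a deviation of `η` whenever `‖X n ω‖ < C`.
  obtain ⟨κ, hκ, hκc, hκη⟩ : ∃ κ : ℝ, 0 < κ ∧ 8 * κ ≤ c ∧ κ * (3 * C ^ 2 + 1) < c / 4 * η ^ 2 := by
    refine ⟨min (c / 8) (c / 8 * η ^ 2 / (3 * C ^ 2 + 1)), by positivity, ?_, ?_⟩
    · linarith [min_le_left (c / 8) (c / 8 * η ^ 2 / (3 * C ^ 2 + 1))]
    · have := min_le_right (c / 8) (c / 8 * η ^ 2 / (3 * C ^ 2 + 1))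
      rw [le_div_iff₀ (by positivity)] at this
      have : 0 < c * η ^ 2 := by positivity
      linarith
  -- Mean at most `κ / 4` plus sampling error `κ / 4` stays within the `κ / 2` allowed for the
  -- average of `w`.
  obtain ⟨r, hr, w, hwm, hwint, hwle, hw⟩ := hexp (κ / 4) (by positivity)
  obtain ⟨ρ, hρ, hball⟩ := Metric.mem_nhds_iff.mp hΘ
  have hHmean (h : E) : inner ℝ h ((∫ z, H z ∂D) h) = -inner ℝ h (A h) := by
    rw [← hHA h, ContinuousLinearMap.integral_apply hHint, integral_inner]
    exact hHint.apply_continuousLinearMap h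
  have hHavg := tendstoInMeasure_average hindep hlaw hHm hHint
  rw [tendstoInMeasure_iff_norm] at hHavg
  have hHlln := hHavg κ hκ
  have hwlln := tendsto_measure_average hindep hlaw hwm hwint (ε := κ / 4) (by positivity)
  have hsmall := ((hmax κ hκ).add (hcons r hr)).add (hHlln.add hwlln)
  rw [add_zero, add_zero] at hsmall
  have hgood : ∀ᵐ ω ∂μ, ∀ i, ∀ h, ‖h‖ ≤ r → |m (Z i ω) (θ₀ + h) - m (Z i ω) θ₀
      - inner ℝ (ψ (Z i ω)) h - inner ℝ h (H (Z i ω) h) / 2| ≤ w (Z i ω) * ‖h‖ ^ 2 := by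
    refine ae_all_iff.mpr fun i => ?_
    rw [← (hlaw i).map_eq] at hw
    exact ae_of_ae_map (p := fun z => ∀ h, ‖h‖ ≤ r → |m z (θ₀ + h) - m z θ₀
      - inner ℝ (ψ z) h - inner ℝ h (H z h) / 2| ≤ w z * ‖h‖ ^ 2) (hlaw i).aemeasurable hw
  -- This puts the competitor `θ₀ + X / √n` both in the ball of the expansion and in `Θ`.
  have hn_large : ∀ᶠ n : ℕ in atTop, C / √(n : ℝ) < min r ρ := by
    refine (Tendsto.div_atTop tendsto_const_nhds
      (Real.tendsto_sqrt_atTop.comp tendsto_natCast_atTop_atTop)).eventually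
      (gt_mem_nhds (lt_min hr hρ))
  filter_upwards [hCev, ENNReal.tendsto_nhds_zero.mp hsmall (ε / 2) (ENNReal.half_pos hε.ne'),
    hn_large, eventually_gt_atTop 0] with n hn1 hn2 hn3 hn
  rw [← ENNReal.add_halves ε]
  refine le_trans ?_ (add_le_add hn1 hn2)
  refine le_trans ?_ (add_le_add le_rfl (add_le_add (measure_union_le _ _) (measure_union_le _ _)))
  refine le_trans ?_ (add_le_add le_rfl (measure_union_le _ _))
  refine le_trans ?_ (measure_union_le _ _)
  refine measure_mono_ae ?_
  filter_upwards [hgood] with ω hω hfar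
  by_contra hcon
  change η ≤ ‖(√(n : ℝ) • (θhat n ω - θ₀) - X n ω) - 0‖ at hfar
  change ¬ (_ ∨ ((_ ∨ _) ∨ (_ ∨ _))) at hcon
  simp only [Set.mem_ofPred_eq, not_or, not_le, not_exists, not_and, not_lt] at hcon
  obtain ⟨hXC, ⟨hmx, hdist⟩, hHn, hwn⟩ := hcon
  have hn' : (0 : ℝ) < n := by exact_mod_cast hn
  have hs : 0 < √(n : ℝ) := Real.sqrt_pos.mpr hn'
  have hwn' : (∑ i ∈ Finset.range n, w (Z i ω)) / n ≤ κ / 2 := by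
    linarith [(abs_lt.mp hwn).2]
  have hxsmall : ‖(√(n : ℝ))⁻¹ • X n ω‖ < min r ρ := by
    refine lt_of_le_of_lt ?_ hn3
    rw [norm_smul, norm_inv, Real.norm_of_nonneg hs.le, inv_mul_eq_div]
    gcongr
  have e1 := abs_sum_sub_quadratic_le hn hω hHmean hHn.le hwn' (hX n ω)
    (h := θhat n ω - θ₀) (by rw [← dist_eq_norm]; exact hdist.le)
  have e2 := abs_sum_sub_quadratic_le hn hω hHmean hHn.le hwn' (hX n ω)
    (h := (√(n : ℝ))⁻¹ • X n ω) (hxsmall.le.trans (min_le_left _ _))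
  rw [smul_inv_smul₀ hs.ne'] at e2
  rw [add_sub_cancel] at e1
  have e3 := hmx (θ₀ + (√(n : ℝ))⁻¹ • X n ω) (hball (by
    rw [Metric.mem_ball, dist_eq_norm, add_sub_cancel_left]
    exact hxsmall.trans_le (min_le_right _ _)))
  have e4 := norm_sub_sq_le_of_quadratic_expansion hsymm hpos hκ.le hκc e1 e2 (by linarith)
  rw [sub_zero] at hfar
  have e5 : c / 4 * η ^ 2 ≤ c / 4 * ‖√(n : ℝ) • (θhat n ω - θ₀) - X n ω‖ ^ 2 := by gcongr
  have e6 : κ * (3 * ‖X n ω‖ ^ 2 + 1) ≤ κ * (3 * C ^ 2 + 1) := by gcongr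
  linarith

end AsymptoticLinearity

/-! ### Second order Taylor expansion through the gradient -/

section Gradient

variable {E : Type*} [NormedAddCommGroup E] [InnerProductSpace ℝ E] [CompleteSpace E]
  {f : E → ℝ} {U : Set E} {θ θ₀ : E}

lemma contDiffOn_gradient (hU : IsOpen U) (hf : ContDiffOn ℝ 2 f U) : ContDiffOn ℝ 1 (∇ f) U :=
  (InnerProductSpace.toDual ℝ E).symm.contDiff.comp_contDiffOn
    (hf.fderiv_of_isOpen hU (by norm_num))

lemma hasFDerivAt_gradient (hU : IsOpen U) (hf : ContDiffOn ℝ 2 f U) (hθ : θ ∈ U) :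
    HasFDerivAt (∇ f) (fderiv ℝ (∇ f) θ) θ :=
  (((contDiffOn_gradient hU hf).differentiableOn (by norm_num)).differentiableAt
    (hU.mem_nhds hθ)).hasFDerivAt

lemma continuousOn_fderiv_gradient (hU : IsOpen U) (hf : ContDiffOn ℝ 2 f U) :
    ContinuousOn (fderiv ℝ (∇ f)) U :=
  (contDiffOn_gradient hU hf).continuousOn_fderiv_of_isOpen hU (by norm_num)

lemma hasGradientAt_of_contDiffOn (hU : IsOpen U) (hf : ContDiffOn ℝ 2 f U) (hθ : θ ∈ U) :
    HasGradientAt f (∇ f θ) θ :=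
  ((hf.differentiableOn (by norm_num)).differentiableAt (hU.mem_nhds hθ)).hasGradientAt

/-- The second order Taylor expansion with a remainder controlled by the oscillation of the
Hessian. -/
lemma abs_taylor_two_remainder_le {r B : ℝ} (hU : IsOpen U) (hf : ContDiffOn ℝ 2 f U)
    (hball : Metric.ball θ₀ r ⊆ U)
    (hB : ∀ θ ∈ Metric.ball θ₀ r, ‖fderiv ℝ (∇ f) θ - fderiv ℝ (∇ f) θ₀‖ ≤ B)
    {h : E} (hh : ‖h‖ < r) :
    |f (θ₀ + h) - f θ₀ - inner ℝ (∇ f θ₀) h - inner ℝ h (fderiv ℝ (∇ f) θ₀ h) / 2|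
      ≤ B * ‖h‖ ^ 2 := by
  set H := fderiv ℝ (∇ f) θ₀ with hH
  have hr : 0 < r := (norm_nonneg h).trans_lt hh
  have h0 : θ₀ ∈ Metric.ball θ₀ r := Metric.mem_ball_self hr
  have hmem {t : ℝ} (ht : t ∈ Set.Icc (0 : ℝ) 1) : θ₀ + t • h ∈ Metric.ball θ₀ r := by
    rw [mem_ball_iff_norm, add_sub_cancel_left, norm_smul, Real.norm_of_nonneg ht.1]
    nlinarith [ht.2, norm_nonneg h]
  have hB0 : 0 ≤ B := (norm_nonneg _).trans (hB θ₀ h0)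
  have hgrad {t : ℝ} (ht : t ∈ Set.Icc (0 : ℝ) 1) :
      ‖∇ f (θ₀ + t • h) - ∇ f θ₀ - t • H h‖ ≤ B * ‖h‖ := by
    have := (convex_ball θ₀ r).norm_image_sub_le_of_norm_hasFDerivWithin_le' (φ := H)
      (fun x hx => (hasFDerivAt_gradient hU hf (hball hx)).hasFDerivWithinAt) hB h0 (hmem ht)
    rw [add_sub_cancel_left, map_smul, norm_smul, Real.norm_of_nonneg ht.1] at this
    refine this.trans (mul_le_mul_of_nonneg_left ?_ hB0)
    nlinarith [ht.2, norm_nonneg h]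
  have hline (t : ℝ) : HasDerivAt (fun t : ℝ => θ₀ + t • h) h t := by
    simpa using ((hasDerivAt_id t).smul_const h).const_add θ₀
  -- The remainder along the segment has derivative at most `B * ‖h‖ ^ 2` by `hgrad`, so the mean
  -- value inequality on `[0, 1]` finishes.
  have hder {t : ℝ} (ht : t ∈ Set.Icc (0 : ℝ) 1) : HasDerivAt
      (fun t : ℝ => f (θ₀ + t • h) - t * inner ℝ (∇ f θ₀) h - t ^ 2 * (inner ℝ h (H h) / 2))
      (inner ℝ (∇ f (θ₀ + t • h) - ∇ f θ₀ - t • H h) h) t := by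
    have h1 := (hasGradientAt_of_contDiffOn hU hf (hball (hmem ht))).hasFDerivAt.comp_hasDerivAt t
      (hline t)
    have h2 := (h1.sub ((hasDerivAt_id t).mul_const (inner ℝ (∇ f θ₀) h))).sub
      ((hasDerivAt_pow 2 t).mul_const (inner ℝ h (H h) / 2))
    refine h2.congr_deriv ?_
    rw [inner_sub_left, inner_sub_left, inner_smul_left, real_inner_comm h (H h)]
    simp
    ring
  have hmv := norm_image_sub_le_of_norm_deriv_le_segment_01' (C := B * ‖h‖ ^ 2)
    (fun t ht => (hder ht).hasDerivWithinAt) (fun t ht => by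
      refine (norm_inner_le_norm _ _).trans ?_
      have := mul_le_mul_of_nonneg_right (hgrad ⟨ht.1, ht.2.le⟩) (norm_nonneg h)
      rw [pow_two, ← mul_assoc]
      exact this)
  convert hmv using 1
  rw [Real.norm_eq_abs]
  congr 1
  simp
  ring

end Gradient

/-! ### Measurability of derivatives in a parameter -/

section Measurability

variable {𝒵 E F : Type*} [MeasurableSpace 𝒵]

/-- A directional derivative is measurable in a parameter if the function is. -/
lemma measurable_fderiv_param_apply [NormedAddCommGroup E] [NormedSpace ℝ E]
    [NormedAddCommGroup F] [NormedSpace ℝ F] [MeasurableSpace F] [BorelSpace F]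
    [SecondCountableTopology F] {G : 𝒵 → E → F} {L : 𝒵 → E →L[ℝ] F} {U : Set E}
    {θ : E} (hU : U ∈ 𝓝 θ) (hG : ∀ θ' ∈ U, Measurable fun z => G z θ')
    (hL : ∀ z, HasFDerivAt (G z) (L z) θ) (v : E) : Measurable fun z => L z v := by
  have htend : Tendsto (fun n : ℕ => θ + (n : ℝ)⁻¹ • v) atTop (𝓝 θ) := by
    simpa using (tendsto_inv_atTop_nhds_zero_nat (𝕜 := ℝ)).smul_const v |>.const_add θ
  obtain ⟨N, hN⟩ := eventually_atTop.mp (htend.eventually hU)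
  -- Difference quotients with step `1 / n`; the shift by `N` keeps every evaluation point in `U`,
  -- where measurability is known.
  refine measurable_of_tendsto_metrizable (f := fun n z =>
    ((n + N : ℕ) : ℝ) • (G z (θ + ((n + N : ℕ) : ℝ)⁻¹ • v) - G z θ)) (fun n => ?_) ?_
  · exact ((hG _ (hN _ (Nat.le_add_left _ _))).sub (hG θ (mem_of_mem_nhds hU))).const_smul _
  · refine tendsto_pi_nhds.mpr fun z => ?_
    have := (hL z).lim v (c := fun n : ℕ => (n : ℝ)) (l := atTop)
      (by simpa using tendsto_natCast_atTop_atTop)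
    exact (tendsto_add_atTop_iff_nat N).mpr this

variable [NormedAddCommGroup E] [InnerProductSpace ℝ E] [FiniteDimensional ℝ E]
  [MeasurableSpace E] [BorelSpace E]

lemma measurable_of_measurable_inner {g : 𝒵 → E}
    (hg : ∀ v, Measurable fun z => inner ℝ v (g z)) : Measurable g := by
  let b := stdOrthonormalBasis ℝ E
  have : g = fun z => ∑ i, (inner ℝ (b i) (g z) : ℝ) • b i := by
    funext z
    exact (b.sum_repr' (g z)).symm
  rw [this]
  exact Finset.measurable_fun_sum _ fun i _ => (hg (b i)).smul_const _

lemma measurable_of_measurable_apply {L : 𝒵 → E →L[ℝ] E}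
    (hL : ∀ v, Measurable fun z => L z v) : Measurable L := by
  let b := stdOrthonormalBasis ℝ E
  have : L = fun z => ∑ i,
      ContinuousLinearMap.smulRightL ℝ E E (innerSL ℝ (b i)) (L z (b i)) := by
    funext z
    ext v
    conv_lhs => rw [← b.sum_repr' v]
    simp
  rw [this]
  exact Finset.measurable_fun_sum _ fun i _ =>
    (ContinuousLinearMap.continuous _).measurable.comp (hL (b i))

end Measurability

/-! ### Quadratic expansion with remainder small in mean -/

section MeanQuadraticExpansion

variable {𝒵 E : Type*} [MeasurableSpace 𝒵] {D : Measure 𝒵}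
  [NormedAddCommGroup E] [InnerProductSpace ℝ E] [FiniteDimensional ℝ E]
  [MeasurableSpace E] [BorelSpace E] {m : 𝒵 → E → ℝ} {U : Set E} {θ₀ : E}

/-- A twice continuously differentiable criterion whose Hessian has an integrable supremum has a
quadratic expansion with a remainder that is uniformly small in mean. -/
lemma exists_mean_quadratic_expansion (hU : IsOpen U) (hθ₀ : θ₀ ∈ U)
    (hm : ∀ θ ∈ U, Measurable fun z => m z θ) (hC2 : ∀ z, ContDiffOn ℝ 2 (m z) U)
    (hψ : Measurable fun z => ∇ (m z) θ₀) (hH : Measurable fun z => fderiv ℝ (∇ (m z)) θ₀)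
    (hbound : ∫⁻ z, ⨆ θ ∈ U, ‖fderiv ℝ (∇ (m z)) θ‖ₑ ∂D < ∞) {ε : ℝ} (hε : 0 < ε) :
    ∃ r > 0, ∃ w : 𝒵 → ℝ, Measurable w ∧ Integrable w D ∧ ∫ z, w z ∂D ≤ ε ∧
      ∀ᵐ z ∂D, ∀ h, ‖h‖ ≤ r → |m z (θ₀ + h) - m z θ₀ - inner ℝ (∇ (m z) θ₀) h
        - inner ℝ h (fderiv ℝ (∇ (m z)) θ₀ h) / 2| ≤ w z * ‖h‖ ^ 2 := by
  obtain ⟨ρ, hρ, hball⟩ := Metric.isOpen_iff.mp hU θ₀ hθ₀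
  set R : 𝒵 → E → ℝ := fun z h => m z (θ₀ + h) - m z θ₀ - inner ℝ (∇ (m z) θ₀) h
    - inner ℝ h (fderiv ℝ (∇ (m z)) θ₀ h) / 2 with hR
  set S : ℕ → Set E := fun k => {h | h ≠ 0 ∧ ‖h‖ < ρ / (k + 1)} with hS
  have hle (k : ℕ) : ρ / ((k : ℝ) + 1) ≤ ρ := by
    refine div_le_self hρ.le ?_
    linarith [Nat.cast_nonneg (α := ℝ) k]
  have hSball {k : ℕ} {h : E} (hh : h ∈ S k) : θ₀ + h ∈ U :=
    hball (by rw [mem_ball_iff_norm, add_sub_cancel_left]; exact hh.2.trans_le (hle k))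
  have hSanti (k : ℕ) : S k ⊆ S 0 := fun h hh => ⟨hh.1, by simpa using hh.2.trans_le (hle k)⟩
  -- The worst relative remainder on a punctured ball. `W 0` itself is the dominating function, so
  -- the supremum of the Hessian norms need not be measurable.
  set W : ℕ → 𝒵 → ℝ≥0∞ := fun k z => ⨆ h ∈ S k, ENNReal.ofReal (|R z h| / ‖h‖ ^ 2) with hW
  have hWm (k : ℕ) : Measurable (W k) := by
    refine measurable_biSup_of_continuousOn (fun z => ?_) fun h hh => ?_
    · refine ENNReal.continuous_ofReal.comp_continuousOn (ContinuousOn.div ?_ (by fun_prop)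
        fun h hh => by simpa using hh.1)
      refine ContinuousOn.abs (ContinuousOn.sub (ContinuousOn.sub (ContinuousOn.sub ?_
        continuousOn_const) (by fun_prop)) (by fun_prop))
      exact (hC2 z).continuousOn.comp (by fun_prop) fun h hh => hSball hh
    · refine ((Measurable.abs ?_).div_const _).ennreal_ofReal
      refine (((hm _ (hSball hh)).sub (hm _ hθ₀)).sub hψ.inner_const).sub ?_
      refine Measurable.div_const ?_ _
      exact ((ContinuousLinearMap.apply ℝ E h).continuous.measurable.comp hH).const_inner
  have hRle {k : ℕ} {z : 𝒵} {B : ℝ} (hB : ∀ θ ∈ Metric.ball θ₀ (ρ / (k + 1)),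
      ‖fderiv ℝ (∇ (m z)) θ - fderiv ℝ (∇ (m z)) θ₀‖ ≤ B) : W k z ≤ ENNReal.ofReal B := by
    refine iSup₂_le fun h hh => ENNReal.ofReal_le_ofReal ?_
    have hpos : 0 < ‖h‖ ^ 2 := by have := norm_pos_iff.mpr hh.1; positivity
    rw [div_le_iff₀ hpos]
    exact abs_taylor_two_remainder_le hU (hC2 z)
      ((Metric.ball_subset_ball (hle k)).trans hball) hB hh.2
  have hWbound (z : 𝒵) : W 0 z ≤ 2 * ⨆ θ ∈ U, ‖fderiv ℝ (∇ (m z)) θ‖ₑ := by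
    by_cases htop : ⨆ θ ∈ U, ‖fderiv ℝ (∇ (m z)) θ‖ₑ = ∞
    · simp [htop]
    set b := ⨆ θ ∈ U, ‖fderiv ℝ (∇ (m z)) θ‖ₑ with hb
    have hbθ {θ : E} (hθ : θ ∈ U) : ‖fderiv ℝ (∇ (m z)) θ‖ ≤ b.toReal := by
      rw [← toReal_enorm]
      exact ENNReal.toReal_mono htop
        (le_iSup₂ (f := fun θ (_ : θ ∈ U) => ‖fderiv ℝ (∇ (m z)) θ‖ₑ) θ hθ)
    refine (hRle (B := 2 * b.toReal) fun θ hθ => ?_).trans ?_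
    · have h1 := hbθ (hball (Metric.ball_subset_ball (hle 0) hθ))
      have h2 := hbθ hθ₀
      linarith [norm_sub_le (fderiv ℝ (∇ (m z)) θ) (fderiv ℝ (∇ (m z)) θ₀)]
    · rw [ENNReal.ofReal_mul (by norm_num), ENNReal.ofReal_toReal htop]
      simp
  have hW0 : ∫⁻ z, W 0 z ∂D ≠ ∞ := by
    refine ne_top_of_le_ne_top ?_ (lintegral_mono hWbound)
    rw [lintegral_const_mul' _ _ (by simp)]
    exact ENNReal.mul_ne_top (by simp) hbound.ne
  have hWanti (k : ℕ) (z : 𝒵) : W k z ≤ W 0 z := biSup_mono fun h hh => hSanti k hh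
  have hWlim (z : 𝒵) : Tendsto (fun k => W k z) atTop (𝓝 0) := by
    rw [ENNReal.tendsto_nhds_zero]
    intro δ hδ
    obtain ⟨B, hB, hBδ⟩ : ∃ B : ℝ, 0 < B ∧ ENNReal.ofReal B ≤ δ := by
      by_cases hδt : δ = ∞
      · exact ⟨1, one_pos, by simp [hδt]⟩
      · exact ⟨δ.toReal, ENNReal.toReal_pos hδ.ne' hδt, ENNReal.ofReal_toReal_le⟩
    have hc := (continuousOn_fderiv_gradient hU (hC2 z)).continuousAt (hU.mem_nhds hθ₀)
    obtain ⟨s, hs, hsub⟩ := Metric.continuousAt_iff.mp hc B hB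
    have hk : Tendsto (fun k : ℕ => ρ / ((k : ℝ) + 1)) atTop (𝓝 0) :=
      tendsto_const_nhds.div_atTop (tendsto_atTop_add_const_right _ _ tendsto_natCast_atTop_atTop)
    filter_upwards [hk.eventually (gt_mem_nhds hs)] with k hks
    refine (hRle fun θ hθ => ?_).trans hBδ
    rw [← dist_eq_norm]
    exact (hsub ((Metric.mem_ball.mp hθ).trans hks)).le
  have hlim := tendsto_lintegral_of_dominated_convergence (μ := D) (W 0) hWm
    (fun k => ae_of_all _ (hWanti k)) hW0 (ae_of_all _ hWlim)
  rw [lintegral_zero] at hlim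
  obtain ⟨k, hk⟩ := (hlim.eventually (gt_mem_nhds (ENNReal.ofReal_pos.mpr hε))).exists
  have hWk : ∫⁻ z, W k z ∂D ≠ ∞ := ne_top_of_lt hk
  have hfin := ae_lt_top (hWm k) hWk
  -- Halving puts the closed ball `‖h‖ ≤ r` inside the open ball of `S k`.
  refine ⟨ρ / (k + 1) / 2, by positivity, fun z => (W k z).toReal, (hWm k).ennreal_toReal,
    integrable_toReal_of_lintegral_ne_top (hWm k).aemeasurable hWk, ?_, ?_⟩
  · rw [integral_toReal (hWm k).aemeasurable hfin]
    exact (ENNReal.toReal_mono ENNReal.ofReal_ne_top hk.le).trans_eq (ENNReal.toReal_ofReal hε.le)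
  · filter_upwards [hfin] with z hz h hh
    by_cases h0 : h = 0
    · simp [h0]
    have hpos : 0 < ‖h‖ ^ 2 := by have := norm_pos_iff.mpr h0; positivity
    have hlt : ‖h‖ < ρ / (k + 1) := by
      have : 0 < ρ / ((k : ℝ) + 1) := by positivity
      linarith
    have hmem : ENNReal.ofReal (|R z h| / ‖h‖ ^ 2) ≤ W k z :=
      le_iSup₂ (f := fun h (_ : h ∈ S k) => ENNReal.ofReal (|R z h| / ‖h‖ ^ 2)) h ⟨h0, hlt⟩
    rw [← div_le_iff₀ hpos]
    exact (ENNReal.ofReal_le_iff_le_toReal hz.ne).mp hmem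

end MeanQuadraticExpansion

/-! ### Choice probabilities sum to one -/

lemma IsErrorDensity.isProbabilityMeasure {K : ℕ} {f : (Fin K → ℝ) → ℝ} (hf : IsErrorDensity f) :
    IsProbabilityMeasure (errorLaw f) :=
  ⟨by rw [errorLaw, withDensity_apply _ MeasurableSet.univ, Measure.restrict_univ,
    hf.lintegral_eq_one]⟩

lemma measurable_latentUtility {K : ℕ} (v : Fin K → ℝ) (S : Matrix (Fin K) (Fin K) ℝ)
    (j : Fin K) : Measurable fun e => latentUtility v S e j := by
  refine Continuous.measurable ?_
  unfold latentUtility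
  exact continuous_const.add
    ((continuous_apply j).comp (continuous_const.matrix_mulVec continuous_id))

/-- Without ties the choice probabilities sum to one. -/
lemma sum_choiceProb_eq_one {K : ℕ} [Nonempty (Fin K)] {f : (Fin K → ℝ) → ℝ}
    (hf : IsErrorDensity f) {v : Fin K → ℝ} {S : Matrix (Fin K) (Fin K) ℝ}
    (hties : ∀ j k, j ≠ k → ∀ᵐ e ∂errorLaw f, latentUtility v S e j ≠ latentUtility v S e k) :
    ∑ j, choiceProb f v S j = 1 := by
  have := hf.isProbabilityMeasure
  set A : Fin K → Set (Fin K → ℝ) := fun j =>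
    {e | ∀ k, k ≠ j → latentUtility v S e k ≤ latentUtility v S e j} with hA
  have hmeas (j : Fin K) : MeasurableSet (A j) := by
    have : A j = ⋂ k, ⋂ (_ : k ≠ j), {e | latentUtility v S e k ≤ latentUtility v S e j} := by
      ext e
      simp [hA]
    rw [this]
    exact MeasurableSet.iInter fun k => MeasurableSet.iInter fun _ =>
      measurableSet_le (measurable_latentUtility v S k) (measurable_latentUtility v S j)
  -- Two choice regions meet only in ties, which are null.
  have hdisj : Pairwise (Function.onFun (AEDisjoint (errorLaw f)) A) := by
    intro j k hjk
    refine measure_mono_null (t := {e | ¬ latentUtility v S e j ≠ latentUtility v S e k}) ?_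
      (ae_iff.mp (hties j k hjk))
    rintro e ⟨hj, hk⟩
    exact not_not.mpr (le_antisymm (hk j hjk) (hj k hjk.symm))
  have hunion : ⋃ j, A j = Set.univ := by
    refine Set.eq_univ_of_forall fun e => ?_
    obtain ⟨j, hj⟩ := Finite.exists_max fun j => latentUtility v S e j
    exact Set.mem_iUnion.mpr ⟨j, fun k _ => hj k⟩
  have hsum := measure_iUnion₀ hdisj fun j => (hmeas j).nullMeasurableSet
  rw [hunion, measure_univ, tsum_fintype] at hsum
  have hreal := congrArg ENNReal.toReal hsum
  rw [ENNReal.toReal_sum fun j _ => measure_ne_top _ _] at hreal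
  exact hreal.symm

/-! ### Score and information identities -/

namespace ChoiceModel

variable {K p : ℕ} {𝒳 : Type*} [MeasurableSpace 𝒳] {M : ChoiceModel K p 𝒳}
  {Θ : Set (EuclideanSpace ℝ (Fin p))} {θ θ₀ : EuclideanSpace ℝ (Fin p)} {Q : Measure 𝒳}

lemma IsProper.sum_prob (hM : M.IsProper Θ) [Nonempty (Fin K)] (hθ : θ ∈ Θ) (x : 𝒳) :
    ∑ j, M.prob x θ j = 1 :=
  sum_choiceProb_eq_one hM.errorDensity (hM.no_ties x θ hθ)

/-- Smoothness is assumed for `m` only; writing the probability as an exponential lets it be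
differentiated through `m`. -/
lemma IsProper.exp_logLik (hM : M.IsProper Θ) (hθ : θ ∈ Θ) (x : 𝒳) (j : Fin K) :
    Real.exp (M.logLik (x, j) θ) = M.prob x θ j :=
  Real.exp_log (hM.prob_pos x θ hθ j)

lemma IsProper.logLik_nonpos (hM : M.IsProper Θ) (z : 𝒳 × Fin K) (θ : EuclideanSpace ℝ (Fin p)) :
    M.logLik z θ ≤ 0 := by
  have := hM.errorDensity.isProbabilityMeasure
  exact Real.log_nonpos measureReal_nonneg measureReal_le_one

lemma IsProper.measurable_logLik (hM : M.IsProper Θ) (hθ : θ ∈ Θ) :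
    Measurable fun z => M.logLik z θ :=
  measurable_from_prod_countable_left fun j => (hM.prob_measurable θ hθ j).log

section Smooth

variable (hC2 : ∀ z, ContDiffOn ℝ 2 (M.logLik z) (interior Θ))
include hC2

lemma hasGradientAt_logLik (hθ : θ ∈ interior Θ) (z : 𝒳 × Fin K) :
    HasGradientAt (M.logLik z) (M.score z θ) θ :=
  hasGradientAt_of_contDiffOn isOpen_interior (hC2 z) hθ

lemma hasFDerivAt_score (hθ : θ ∈ interior Θ) (z : 𝒳 × Fin K) :
    HasFDerivAt (M.score z) (M.hessian z θ) θ :=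
  hasFDerivAt_gradient isOpen_interior (hC2 z) hθ

lemma IsProper.measurable_score (hM : M.IsProper Θ) (hθ : θ ∈ interior Θ) :
    Measurable fun z => M.score z θ := by
  refine measurable_of_measurable_inner fun v => ?_
  have := measurable_fderiv_param_apply (isOpen_interior.mem_nhds hθ)
    (fun θ' hθ' => hM.measurable_logLik (interior_subset hθ'))
    (fun z => (hasGradientAt_logLik hC2 hθ z).hasFDerivAt) v
  simpa [real_inner_comm] using this

lemma IsProper.measurable_hessian (hM : M.IsProper Θ) (hθ : θ ∈ interior Θ) :
    Measurable fun z => M.hessian z θ :=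
  measurable_of_measurable_apply fun v =>
    measurable_fderiv_param_apply (isOpen_interior.mem_nhds hθ)
      (fun _ hθ' => hM.measurable_score hC2 hθ') (fun z => hasFDerivAt_score hC2 hθ z) v

/-- The score has conditional mean zero. -/
lemma IsProper.sum_prob_mul_score (hM : M.IsProper Θ) [Nonempty (Fin K)] (hθ : θ ∈ interior Θ)
    (x : 𝒳) (h : EuclideanSpace ℝ (Fin p)) :
    ∑ j, M.prob x θ j * inner ℝ (M.score (x, j) θ) h = 0 := by
  have hd : HasFDerivAt (fun θ' => ∑ j, Real.exp (M.logLik (x, j) θ')) _ θ :=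
    HasFDerivAt.fun_sum fun j _ => ((hasGradientAt_logLik hC2 hθ (x, j)).hasFDerivAt).exp
  have hconst : (fun θ' => ∑ j, Real.exp (M.logLik (x, j) θ')) =ᶠ[𝓝 θ] fun _ => (1 : ℝ) := by
    filter_upwards [isOpen_interior.mem_nhds hθ] with θ' hθ'
    simp_rw [hM.exp_logLik (interior_subset hθ')]
    exact hM.sum_prob (interior_subset hθ') x
  have := congrArg (fun L => L h) (hd.unique ((hasFDerivAt_const (1 : ℝ) θ).congr_of_eventuallyEq
    hconst))
  simpa [hM.exp_logLik (interior_subset hθ), sum_apply] using this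

/-- The conditional information equality. -/
lemma IsProper.sum_prob_mul_hessian (hM : M.IsProper Θ) [Nonempty (Fin K)]
    (hθ : θ ∈ interior Θ) (x : 𝒳) (h : EuclideanSpace ℝ (Fin p)) :
    ∑ j, M.prob x θ j *
      (inner ℝ (M.score (x, j) θ) h ^ 2 + inner ℝ h (M.hessian (x, j) θ h)) = 0 := by
  -- The mean-zero identity of the score in direction `h` holds throughout the interior, so it may
  -- be differentiated again.
  have hd : HasFDerivAt (fun θ' => ∑ j, Real.exp (M.logLik (x, j) θ') *
      innerSL ℝ h (M.score (x, j) θ')) _ θ :=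
    HasFDerivAt.fun_sum fun j _ => ((hasGradientAt_logLik hC2 hθ (x, j)).hasFDerivAt).exp.mul
      ((innerSL ℝ h).hasFDerivAt.comp θ (hasFDerivAt_score hC2 hθ (x, j)))
  have hconst : (fun θ' => ∑ j, Real.exp (M.logLik (x, j) θ') *
      innerSL ℝ h (M.score (x, j) θ')) =ᶠ[𝓝 θ] fun _ => (0 : ℝ) := by
    filter_upwards [isOpen_interior.mem_nhds hθ] with θ' hθ'
    simp_rw [hM.exp_logLik (interior_subset hθ'), innerSL_apply_apply,
      ← hM.sum_prob_mul_score hC2 hθ' x h, real_inner_comm h]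
  have := congrArg (fun L => L h) (hd.unique ((hasFDerivAt_const (0 : ℝ) θ).congr_of_eventuallyEq
    hconst))
  simp only [hM.exp_logLik (interior_subset hθ), sum_apply,
    add_apply, smul_apply, zero_apply, ContinuousLinearMap.comp_apply, innerSL_apply_apply,
    InnerProductSpace.toDual_apply_apply, smul_eq_mul, real_inner_comm (M.score _ θ) h] at this
  rw [← this]
  refine Finset.sum_congr rfl fun j _ => ?_
  rw [real_inner_comm h]
  ring

end Smooth

/-- A function of an observation has mean zero if its conditional mean vanishes. -/
lemma IsProper.integral_observationLaw_eq_zero (hM : M.IsProper Θ) (hθ : θ ∈ Θ)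
    {F : 𝒳 × Fin K → ℝ} (hF : Measurable F) (hint : Integrable F (M.observationLaw Q θ))
    (hzero : ∀ x, ∑ j, M.prob x θ j * F (x, j) = 0) :
    ∫ z, F z ∂M.observationLaw Q θ = 0 := by
  have hP (j : Fin K) : Measurable fun x => ENNReal.ofReal (M.prob x θ j) :=
    (hM.prob_measurable θ hθ j).ennreal_ofReal
  have hreal (x : 𝒳) (j : Fin K) : (ENNReal.ofReal (M.prob x θ j)).toReal = M.prob x θ j :=
    ENNReal.toReal_ofReal (hM.prob_pos x θ hθ j).le
  rw [observationLaw, integrable_finsetSum_measure] at hint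
  rw [observationLaw, integral_finsetSum_measure hint]
  have hint' (j : Fin K) : Integrable (fun x => M.prob x θ j * F (x, j)) Q := by
    have h1 := (integrable_map_measure hF.aestronglyMeasurable
      measurable_prodMk_right.aemeasurable).mp (hint j (Finset.mem_univ j))
    rw [integrable_withDensity_iff_integrable_smul' (hP j)
      (ae_of_all _ fun x => ENNReal.ofReal_lt_top)] at h1
    simpa [hreal] using h1
  have hterm (j : Fin K) : ∫ z, F z ∂((Q.withDensity fun x => ENNReal.ofReal (M.prob x θ j)).map
      fun x => (x, j)) = ∫ x, M.prob x θ j * F (x, j) ∂Q := by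
    rw [integral_map measurable_prodMk_right.aemeasurable hF.aestronglyMeasurable,
      integral_withDensity_eq_integral_toReal_smul (hP j)
        (ae_of_all _ fun x => ENNReal.ofReal_lt_top)]
    simp [hreal]
  simp_rw [hterm]
  rw [← integral_finsetSum _ fun j _ => hint' j]
  simp [hzero]

section Regular

variable {D : Measure (𝒳 × Fin K)}

lemma IsRegular.memLp_score (hM : M.IsProper Θ) (hR : M.IsRegular Θ D θ₀)
    (hθ : θ ∈ interior Θ) : MemLp (fun z => M.score z θ) 2 D := by
  refine ⟨(hM.measurable_score hR.contDiffOn hθ).aestronglyMeasurable, ?_⟩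
  rw [eLpNorm_lt_top_iff_lintegral_rpow_enorm_lt_top (by norm_num) (by norm_num)]
  refine lt_of_le_of_lt (lintegral_mono fun z => ?_) hR.score_bound
  simpa using le_iSup₂ (f := fun θ (_ : θ ∈ interior Θ) => ‖M.score z θ‖ₑ ^ 2) θ hθ

lemma IsRegular.integrable_hessian (hM : M.IsProper Θ) (hR : M.IsRegular Θ D θ₀)
    (hθ : θ ∈ interior Θ) : Integrable (fun z => M.hessian z θ) D := by
  refine ⟨(hM.measurable_hessian hR.contDiffOn hθ).aestronglyMeasurable, ?_⟩
  refine lt_of_le_of_lt (lintegral_mono fun z => ?_) hR.hessian_bound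
  exact le_iSup₂ (f := fun θ (_ : θ ∈ interior Θ) => ‖M.hessian z θ‖ₑ) θ hθ

lemma IsRegular.integral_inner_score_sq (hM : M.IsProper Θ) (hR : M.IsRegular Θ D θ₀)
    (hθ : θ ∈ interior Θ) (t : EuclideanSpace ℝ (Fin p)) :
    ∫ z, inner ℝ (M.score z θ) t ^ 2 ∂D = t.ofLp ⬝ᵥ (M.fisherInfo D θ).mulVec t.ofLp := by
  have hL2 (a : Fin p) : MemLp (fun z => M.score z θ a) 2 D := by
    have := (hR.memLp_score hM hθ).inner_const (𝕜 := ℝ) (EuclideanSpace.single a (1 : ℝ))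
    simpa [EuclideanSpace.inner_single_right] using this
  have hint (a b : Fin p) : Integrable (fun z => M.score z θ a * M.score z θ b) D :=
    (hL2 a).integrable_mul (hL2 b)
  have hsq (z : 𝒳 × Fin K) : inner ℝ (M.score z θ) t ^ 2 =
      ∑ a, ∑ b, t a * t b * (M.score z θ a * M.score z θ b) := by
    rw [PiLp.inner_apply, pow_two, Finset.sum_mul_sum]
    refine Finset.sum_congr rfl fun a _ => Finset.sum_congr rfl fun b _ => ?_
    simp
    ring
  simp_rw [hsq]
  rw [integral_finsetSum _ fun a _ => integrable_finsetSum _ fun b _ => (hint a b).const_mul _]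
  simp only [dotProduct, Matrix.mulVec, Finset.mul_sum]
  refine Finset.sum_congr rfl fun a _ => ?_
  rw [integral_finsetSum _ fun b _ => (hint a b).const_mul _]
  refine Finset.sum_congr rfl fun b _ => ?_
  rw [integral_const_mul]
  simp only [fisherInfo, Matrix.of_apply]
  ring

end Regular

section Information

variable [Nonempty (Fin K)] (hM : M.IsProper Θ)
  (hR : M.IsRegular Θ (M.observationLaw Q θ₀) θ₀)
include hM hR

lemma IsRegular.integral_inner_score [IsFiniteMeasure (M.observationLaw Q θ₀)]
    (t : EuclideanSpace ℝ (Fin p)) :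
    ∫ z, inner ℝ (M.score z θ₀) t ∂M.observationLaw Q θ₀ = 0 :=
  hM.integral_observationLaw_eq_zero (interior_subset hR.mem_interior)
    (hM.measurable_score hR.contDiffOn hR.mem_interior).inner_const
    (((hR.memLp_score hM hR.mem_interior).inner_const t).integrable one_le_two)
    fun x => hM.sum_prob_mul_score hR.contDiffOn hR.mem_interior x t

/-- The information equality. -/
lemma IsRegular.integral_inner_hessian (t : EuclideanSpace ℝ (Fin p)) :
    ∫ z, inner ℝ t (M.hessian z θ₀ t) ∂M.observationLaw Q θ₀ =
      -(t.ofLp ⬝ᵥ (M.fisherInfo (M.observationLaw Q θ₀) θ₀).mulVec t.ofLp) := by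
  have hs := hM.measurable_score hR.contDiffOn hR.mem_interior
  have hH := hM.measurable_hessian hR.contDiffOn hR.mem_interior
  have hH' : Measurable fun z => inner ℝ t (M.hessian z θ₀ t) :=
    ((ContinuousLinearMap.apply ℝ _ t).continuous.measurable.comp hH).const_inner
  have h1 : Integrable (fun z => inner ℝ (M.score z θ₀) t ^ 2) (M.observationLaw Q θ₀) :=
    ((hR.memLp_score hM hR.mem_interior).inner_const t).integrable_sq
  have h2 : Integrable (fun z => inner ℝ t (M.hessian z θ₀ t)) (M.observationLaw Q θ₀) :=
    ((hR.integrable_hessian hM hR.mem_interior).apply_continuousLinearMap t).const_inner t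
  have h3 := hM.integral_observationLaw_eq_zero (Q := Q) (interior_subset hR.mem_interior)
    (F := fun z => inner ℝ (M.score z θ₀) t ^ 2 + inner ℝ t (M.hessian z θ₀ t))
    ((hs.inner_const.pow_const 2).add hH') (h1.add h2)
    fun x => hM.sum_prob_mul_hessian hR.contDiffOn hR.mem_interior x t
  rw [integral_add h1 h2, hR.integral_inner_score_sq hM hR.mem_interior] at h3
  linarith

end Information

end ChoiceModel

/-! ### From the emulator to the likelihood, and the limit law -/

/-- A positive definite matrix defines a coercive quadratic form. -/
lemma Matrix.PosDef.exists_mul_norm_sq_le_inner {p : ℕ} {J : Matrix (Fin p) (Fin p) ℝ}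
    (hJ : J.PosDef) : ∃ c : ℝ, 0 < c ∧ ∀ v : EuclideanSpace ℝ (Fin p),
      c * ‖v‖ ^ 2 ≤ inner ℝ v (Matrix.toEuclideanCLM (𝕜 := ℝ) J v) := by
  -- A positive lower bound on the unit sphere, extended by homogeneity. The form used also covers
  -- the empty sphere of `p = 0`.
  obtain ⟨c, hc, hcs⟩ := (isCompact_sphere (0 : EuclideanSpace ℝ (Fin p)) 1).exists_forall_le'
    (f := fun v => inner ℝ v (Matrix.toEuclideanCLM (𝕜 := ℝ) J v)) (a := 0)
    (by fun_prop) fun v hv => by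
      have hv0 : v.ofLp ≠ 0 := by
        intro h
        have : v = 0 := by ext i; simp [h]
        simp [this] at hv
      simpa [Matrix.inner_toEuclideanCLM] using hJ.dotProduct_mulVec_pos hv0
  refine ⟨c, hc, fun v => ?_⟩
  by_cases hv : v = 0
  · simp [hv]
  have hn : 0 < ‖v‖ := norm_pos_iff.mpr hv
  have h := hcs (‖v‖⁻¹ • v) (by simp [norm_smul, hn.ne'])
  rw [map_smul, inner_smul_left, inner_smul_right] at h
  simp only [conj_trivial] at h
  have h1 := mul_le_mul_of_nonneg_right h (sq_nonneg ‖v‖)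
  have h2 : ‖v‖⁻¹ * (‖v‖⁻¹ * inner ℝ v (Matrix.toEuclideanCLM (𝕜 := ℝ) J v)) * ‖v‖ ^ 2 =
      inner ℝ v (Matrix.toEuclideanCLM (𝕜 := ℝ) J v) := by
    field_simp
  rwa [h2] at h1

/-- A near-maximizer over `Θ` of a criterion which is uniformly close to `ℓ` is a near-maximizer
of `ℓ`. -/
lemma le_add_of_iSup_abs_sub_le {T : Type*} {Θ : Set T} {L ℓ : T → ℝ} {t : T} {a b : ℝ}
    (ha : 0 ≤ a) (hb : 0 ≤ b)
    (hclose : ⨆ θ ∈ Θ, ENNReal.ofReal |L θ - ℓ θ| ≤ ENNReal.ofReal a)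
    (hmax : ⨆ θ ∈ Θ, ENNReal.ofReal (L θ - L t) ≤ ENNReal.ofReal b) (ht : t ∈ Θ)
    {θ : T} (hθ : θ ∈ Θ) : ℓ θ ≤ ℓ t + (2 * a + b) := by
  have h1 {s : T} (hs : s ∈ Θ) : |L s - ℓ s| ≤ a :=
    (ENNReal.ofReal_le_ofReal_iff ha).mp ((iSup₂_le_iff.mp hclose) s hs)
  have h2 : L θ - L t ≤ b := (ENNReal.ofReal_le_ofReal_iff hb).mp ((iSup₂_le_iff.mp hmax) θ hθ)
  have h3 := abs_le.mp (h1 hθ)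
  have h4 := abs_le.mp (h1 ht)
  linarith

/-- A maximizer of the emulator log-likelihood up to `o_p(n⁻¹)` maximizes the log-likelihood up to
`o_p(n⁻¹)`. -/
lemma ChoiceModel.tendsto_measure_exists_logLik_gt {K p : ℕ} {𝒳 Ω : Type*} [MeasurableSpace Ω]
    {μ : Measure Ω} {M : ChoiceModel K p 𝒳} {Θ : Set (EuclideanSpace ℝ (Fin p))}
    {Z : ℕ → Ω → 𝒳 × Fin K}
    {P : ℕ → Ω → (Fin K → ℝ) → Matrix (Fin K) (Fin K) ℝ → Fin K → ℝ}
    {α : ℝ} (hα : 1 ≤ α)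
    (happrox : IsLittleOInProb μ (fun n ω => ⨆ θ ∈ Θ, ENNReal.ofReal
      |M.emulatorAvgLogLik (P n ω) n (fun i => Z i ω) θ - M.avgLogLik n (fun i => Z i ω) θ|)
      (fun n => (n : ℝ) ^ (-α)))
    {θhat : ℕ → Ω → EuclideanSpace ℝ (Fin p)} (hmem : ∀ n, ∀ᵐ ω ∂μ, θhat n ω ∈ Θ)
    (hmax : IsLittleOInProb μ (fun n ω => ⨆ θ ∈ Θ, ENNReal.ofReal
      (M.emulatorAvgLogLik (P n ω) n (fun i => Z i ω) θ
        - M.emulatorAvgLogLik (P n ω) n (fun i => Z i ω) (θhat n ω))) (fun n => (n : ℝ)⁻¹))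
    {δ : ℝ} (hδ : 0 < δ) :
    Tendsto (fun n : ℕ => μ {ω | ∃ θ ∈ Θ,
      ∑ i ∈ Finset.range n, M.logLik (Z i ω) (θhat n ω) + δ <
        ∑ i ∈ Finset.range n, M.logLik (Z i ω) θ}) atTop (𝓝 0) := by
  -- Thirds, because the approximation error enters twice and the optimization error once.
  have h := (happrox (δ / 3) (by positivity)).add (hmax (δ / 3) (by positivity))
  rw [add_zero] at h
  refine tendsto_of_tendsto_of_tendsto_of_le_of_le' tendsto_const_nhds h
    (Eventually.of_forall fun _ => zero_le) ?_
  filter_upwards [eventually_ge_atTop 1] with n hn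
  refine le_trans (measure_mono_ae ?_) (measure_union_le _ _)
  filter_upwards [hmem n] with ω hω hgt
  by_contra hcon
  change ¬ (_ ∨ _) at hcon
  simp only [Set.mem_ofPred_eq, not_or, not_lt] at hcon
  obtain ⟨θ, hθ, hlt⟩ := hgt
  have hn1 : (1 : ℝ) ≤ n := by exact_mod_cast hn
  have hn0 : (0 : ℝ) < n := by linarith
  have hrate : (n : ℝ) ^ (-α) ≤ (n : ℝ)⁻¹ := by
    rw [← Real.rpow_neg_one]
    exact Real.rpow_le_rpow_of_exponent_le hn1 (by linarith)
  have hle := le_add_of_iSup_abs_sub_le (by positivity) (by positivity) hcon.1 hcon.2 hω hθ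
  simp only [avgLogLik] at hle
  have hle' : (∑ i ∈ Finset.range n, M.logLik (Z i ω) θ) / n ≤
      (∑ i ∈ Finset.range n, M.logLik (Z i ω) (θhat n ω)) / n + δ / n := by
    refine hle.trans ?_
    rw [div_eq_mul_inv δ (n : ℝ)]
    have := mul_le_mul_of_nonneg_left hrate hδ.le
    linarith
  rw [← add_div, div_le_div_iff_of_pos_right hn0] at hle'
  linarith

/-- Observations `Z i = (X_i, y_i)`; an emulator `Phat v Σ φ` with (possibly random) trained weights
`φ n`; `θhat n` maximizes the emulator log-likelihood over `Θ` up to an error `o_p(n⁻¹)`, which is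
zero for an exact maximizer. -/
theorem theorem4 {K p : ℕ} {𝒳 Ω Φ : Type*} [MeasurableSpace 𝒳] [MeasurableSpace Ω]
    (μ : Measure Ω) [IsProbabilityMeasure μ]
    (M : ChoiceModel K p 𝒳) (Θ : Set (EuclideanSpace ℝ (Fin p)))
    (θ₀ : EuclideanSpace ℝ (Fin p)) (Q : Measure 𝒳) [IsProbabilityMeasure Q]
    (hproper : M.IsProper Θ)
    (hregular : M.IsRegular Θ (M.observationLaw Q θ₀) θ₀)
    (Z : ℕ → Ω → 𝒳 × Fin K)
    (hindep : iIndepFun Z μ)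
    (hlaw : ∀ i, HasLaw (Z i) (M.observationLaw Q θ₀) μ)
    (Phat : (Fin K → ℝ) → Matrix (Fin K) (Fin K) ℝ → Φ → Fin K → ℝ)
    (φ : ℕ → Ω → Φ)
    (hPhat : ∀ n ω x, ∀ θ ∈ Θ, ∀ j, 0 < Phat (M.utility x θ) (M.scale x θ) (φ n ω) j)
    (α : ℝ) (hα : 1 ≤ α)
    (happrox : IsLittleOInProb μ
      (fun n ω => ⨆ θ ∈ Θ, ENNReal.ofReal
        |M.emulatorAvgLogLik (fun v S => Phat v S (φ n ω)) n (fun i => Z i ω) θ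
          - M.avgLogLik n (fun i => Z i ω) θ|)
      (fun n => (n : ℝ) ^ (-α)))
    (θhat : ℕ → Ω → EuclideanSpace ℝ (Fin p))
    (hmeas : ∀ n, AEMeasurable (θhat n) μ)
    (hmem : ∀ n, ∀ᵐ ω ∂μ, θhat n ω ∈ Θ)
    (hmax : IsLittleOInProb μ
      (fun n ω => ⨆ θ ∈ Θ, ENNReal.ofReal
        (M.emulatorAvgLogLik (fun v S => Phat v S (φ n ω)) n (fun i => Z i ω) θ
          - M.emulatorAvgLogLik (fun v S => Phat v S (φ n ω)) n (fun i => Z i ω) (θhat n ω)))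
      (fun n => (n : ℝ)⁻¹)) :
    TendstoInDistribution (fun (n : ℕ) ω => √(n : ℝ) • (θhat n ω - θ₀)) atTop id
      (fun _ => μ)
      (multivariateGaussian 0 (M.fisherInfo (M.observationLaw Q θ₀) θ₀)⁻¹) := by
  have hΩ : Nonempty Ω := nonempty_of_isProbabilityMeasure μ
  have hK : Nonempty (Fin K) := ⟨(Z 0 hΩ.some).2⟩
  have hD : IsProbabilityMeasure (M.observationLaw Q θ₀) := by
    rw [← (hlaw 0).map_eq]
    exact Measure.isProbabilityMeasure_map (hlaw 0).aemeasurable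
  set D := M.observationLaw Q θ₀
  have hθ₀ := hregular.mem_interior
  have hC2 := hregular.contDiffOn
  have hψm := hproper.measurable_score hC2 hθ₀
  set J := M.fisherInfo D θ₀
  have hJ : J.PosDef := hregular.fisherInfo_posDef
  have hJunit : IsUnit J.det := (Matrix.isUnit_iff_isUnit_det J).mp hJ.isUnit
  set A := Matrix.toEuclideanCLM (𝕜 := ℝ) J
  set A' := Matrix.toEuclideanCLM (𝕜 := ℝ) J⁻¹
  have hsymm {S : Matrix (Fin p) (Fin p) ℝ} (hS : S.IsHermitian)
      (v w : EuclideanSpace ℝ (Fin p)) : inner ℝ (Matrix.toEuclideanCLM (𝕜 := ℝ) S v) w =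
        inner ℝ v (Matrix.toEuclideanCLM (𝕜 := ℝ) S w) := by
    have hS' : S.transpose = S := by simpa [Matrix.IsHermitian] using hS
    rw [real_inner_comm, Matrix.inner_toEuclideanCLM, Matrix.inner_toEuclideanCLM,
      Matrix.dotProduct_mulVec, ← Matrix.mulVec_transpose, hS', dotProduct_comm]
  have hAA' (v : EuclideanSpace ℝ (Fin p)) : A (A' v) = v := by
    have : A * A' = 1 := by
      rw [← map_mul, Matrix.mul_nonsing_inv J hJunit, map_one]
    exact congrArg (fun L => L v) this
  obtain ⟨c, hc, hcoer⟩ := hJ.exists_mul_norm_sq_le_inner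
  have hnear (δ : ℝ) (hδ : 0 < δ) :=
    ChoiceModel.tendsto_measure_exists_logLik_gt hα happrox hmem hmax hδ
  have hcons (r : ℝ) (hr : 0 < r) :
      Tendsto (fun n => μ {ω | r ≤ dist (θhat n ω) θ₀}) atTop (𝓝 0) := by
    refine tendsto_measure_approx_max_far (m := M.logLik) hindep hlaw hregular.isCompact
      (interior_subset hθ₀) (fun θ hθ => hproper.measurable_logLik hθ) hregular.continuousOn
      (fun z θ _ => hproper.logLik_nonpos z θ) hregular.integrable (fun θ hθ hne => ?_) hmem
      (fun δ hδ => ?_) hr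
    · have h := hregular.unique_max θ hθ hne
      simpa [ChoiceModel.expectedLogLik, EReal.neg_lt_neg_iff] using h
    -- A loss of `δ` in the average is a loss of `n * δ ≥ δ` in the sum.
    · refine tendsto_of_tendsto_of_tendsto_of_le_of_le' tendsto_const_nhds (hnear δ hδ)
        (Eventually.of_forall fun _ => zero_le) ?_
      filter_upwards [eventually_ge_atTop 1] with n hn
      refine measure_mono fun ω hω => ⟨θ₀, interior_subset hθ₀, ?_⟩
      have hn1 : (1 : ℝ) ≤ n := by exact_mod_cast hn
      have hn0 : (0 : ℝ) < n := by linarith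
      have hω' : (∑ i ∈ Finset.range n, M.logLik (Z i ω) (θhat n ω)) / n + δ <
        (∑ i ∈ Finset.range n, M.logLik (Z i ω) θ₀) / n := hω
      rw [lt_div_iff₀ hn0, add_mul, div_mul_cancel₀ _ hn0.ne'] at hω'
      have := mul_le_mul_of_nonneg_left hn1 hδ.le
      linarith
  -- `A' (M.score z θ₀)` is the influence function `J⁻¹ ψ`, whose normalized sum is `X`.
  have hg : Measurable fun z => A' (M.score z θ₀) := A'.continuous.measurable.comp hψm
  have hinner (z : 𝒳 × Fin K) (t : EuclideanSpace ℝ (Fin p)) :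
      inner ℝ (A' (M.score z θ₀)) t = inner ℝ (M.score z θ₀) (A' t) :=
    hsymm hJ.inv.isHermitian _ _
  have hclt := tendstoInDistribution_multivariateGaussian hJ.inv.posSemidef hindep hlaw hg
    (A'.comp_memLp' (hregular.memLp_score hproper hθ₀))
    (fun t => by
      simp_rw [hinner]
      exact hregular.integral_inner_score hproper _)
    (fun t => by
      simp_rw [hinner]
      rw [hregular.integral_inner_score_sq hproper hθ₀, ← Matrix.inner_toEuclideanCLM,
        ← Matrix.inner_toEuclideanCLM]
      change inner ℝ (A' t) (A (A' t)) = inner ℝ t (A' t)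
      rw [hAA', real_inner_comm])
  -- Slutsky: it remains to show that the difference from `X` vanishes in probability.
  refine tendstoInDistribution_of_tendstoInMeasure_sub _ _ hclt ?_
    fun n => ((hmeas n).sub_const θ₀).const_smul (√(n : ℝ))
  refine tendstoInMeasure_sqrt_smul_sub (m := M.logLik) (ψ := fun z => M.score z θ₀)
    (H := fun z => M.hessian z θ₀) (A := A) hindep hlaw (mem_interior_iff_mem_nhds.mp hθ₀)
    (hproper.measurable_hessian hC2 hθ₀) (hregular.integrable_hessian hproper hθ₀)
    (hsymm hJ.isHermitian) hc hcoer (fun h => ?_) (fun ε hε => ?_) (fun n ω => ?_)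
    (fun ε hε => TendstoInDistribution.exists_eventually_measure_norm_ge_le hclt hε) hcons hnear
  · rw [hregular.integral_inner_hessian hproper, ← Matrix.inner_toEuclideanCLM]
  · exact exists_mean_quadratic_expansion isOpen_interior hθ₀
      (fun θ hθ => hproper.measurable_logLik (interior_subset hθ)) hC2 hψm
      (hproper.measurable_hessian hC2 hθ₀) hregular.hessian_bound hε
  · rw [map_smul, map_sum]
    simp_rw [hAA']

end
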